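/- Let $0<\mu\le \tfrac12$ and let $\beta_1,\beta_2\in\mathbb R$ satisfy $(\beta_1-1)(\beta_2-1)<1$. The planar circular restricted charged three-body problem is the Hamiltonian system $\dot x=H_{p_x}$, $\dot y=H_{p_y}$, $\dot p_x=-H_x$, $\dot p_y=-H_y$ with $$H(x,y,p_x,p_y)=\tfrac12(p_x^2+p_y^2)+(y\,p_x-x\,p_y)-V,\qquad V=\frac{\beta_1(1-\mu)}{\rho_1}+\frac{\beta_2\,\mu}{\rho_2},$$ where $\rho_1=\sqrt{(x+\mu)^2+y^2}$ and $\rho_2=\sqrt{(x-1+\mu)^2+y^2}$ are the (nonzero) distances to the primaries $s_1=(-\mu,0)$ and $s_2=(1-\mu,0)$. Let $z$ be either (a) a triangular equilibrium, that is, an equilibrium with $y\neq0$; or (b) a collinear limit of triangular equilibria, that is, $\beta_1,\beta_2>0$ and $z=(x,0,0,x)$ with one of: $x=-\mu-\beta_1^{1/3}$ and $\beta_2^{1/3}-\beta_1^{1/3}=1$; $x=-\mu+\beta_1^{1/3}$ and $\beta_1^{1/3}+\beta_2^{1/3}=1$; $x=-\mu+\beta_1^{1/3}$ and $\beta_1^{1/3}-\beta_2^{1/3}=1$.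 Let $\gamma=\gamma_1+\gamma_2$, where $\gamma_i\in[0,\pi]$ is the angle at $s_i$ between the segment joining the two primaries and the segment from $s_i$ to $(x,y)$, and let $F(\mu,\gamma)=1-36\mu(1-\mu)\sin^2\gamma$. Let $A$ be the matrix of the linearization of the system at $z$, that is, $A=J\,\mathrm{Hess}\,H(z)$ with $J=\begin{pmatrix}0&I\\-I&0\end{pmatrix}$. Call $z$ linearly stable if the zero solution of $\dot\xi=A\xi$ is Lyapunov stable, and linearly unstable otherwise. Then $z$ is an equilibrium, and: 1. If $F(\mu,\gamma)<0$, then $z$ is unstable in the Lyapunov sense (for the full nonlinear system). 2. If $F(\mu,\gamma)=0$, then $z$ is linearly unstable; $A$ has a repeated eigenvalue and is not diagonalizable over $\mathbb C$. 3. If $0<F(\mu,\gamma)<1$, then $z$ is linearly stable. 4. If $F(\mu,\gamma)=1$, then $z$ is linearly unstable; $A$ has a repeated eigenvalue and is not diagonalizable over $\mathbb C$. -/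

import Mathlib

noncomputable section

namespace ChargedRestricted

/-! ## Lyapunov stability -/

/-- Lyapunov stability of the point `p` for the autonomous equation `z' = X z` on `U`: for every
`ε > 0` there is a `δ > 0` such that every solution in `U`, on any interval `[0, T]`, that starts
at distance less than `δ` from `p` stays at distance less than `ε` from `p`. -/
def IsLyapunovStable {E : Type*} [NormedAddCommGroup E] [NormedSpace ℝ E]
    (X : E → E) (U : Set E) (p : E) : Prop :=
  ∀ ε > 0, ∃ δ > 0, ∀ T : ℝ, 0 ≤ T → ∀ z : ℝ → E,
    IsIntegralCurveOn z (fun _ => X) (Set.Icc 0 T) →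
    (∀ t ∈ Set.Icc 0 T, z t ∈ U) →
    ‖z 0 - p‖ < δ → ∀ t ∈ Set.Icc 0 T, ‖z t - p‖ < ε

/-! ## The planar circular restricted charged three-body problem

A phase point is `z = (x, y, p_x, p_y)`. The primaries sit at `(-μ, 0)` and `(1 - μ, 0)`. -/

/-- Distance from `(x, y)` to the primary at `(-μ, 0)`. -/
def rho1 (μ : ℝ) (z : Fin 4 → ℝ) : ℝ := √((z 0 + μ) ^ 2 + z 1 ^ 2)

/-- Distance from `(x, y)` to the primary at `(1 - μ, 0)`. -/
def rho2 (μ : ℝ) (z : Fin 4 → ℝ) : ℝ := √((z 0 - 1 + μ) ^ 2 + z 1 ^ 2)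

/-- The phase space: no collision with a primary. -/
def phaseSpace (μ : ℝ) : Set (Fin 4 → ℝ) := {z | rho1 μ z ≠ 0 ∧ rho2 μ z ≠ 0}

/-- The potential `V`. -/
def potential (μ β₁ β₂ : ℝ) (z : Fin 4 → ℝ) : ℝ :=
  β₁ * (1 - μ) / rho1 μ z + β₂ * μ / rho2 μ z

/-- The Hamiltonian in the rotating frame. -/
def hamiltonian (μ β₁ β₂ : ℝ) (z : Fin 4 → ℝ) : ℝ :=
  (z 2 ^ 2 + z 3 ^ 2) / 2 + (z 1 * z 2 - z 0 * z 3) - potential μ β₁ β₂ z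

/-- The partial derivative `∂f/∂zᵢ`. -/
def partialDeriv (i : Fin 4) (f : (Fin 4 → ℝ) → ℝ) (z : Fin 4 → ℝ) : ℝ :=
  fderiv ℝ f z (Pi.single i 1)

/-- The standard symplectic matrix. -/
def symplecticJ : Matrix (Fin 4) (Fin 4) ℝ :=
  !![0, 0, 1, 0; 0, 0, 0, 1; -1, 0, 0, 0; 0, -1, 0, 0]

/-- The Hamiltonian vector field `J ∇H`. -/
def hamiltonianField (μ β₁ β₂ : ℝ) (z : Fin 4 → ℝ) : Fin 4 → ℝ :=
  symplecticJ.mulVec fun i => partialDeriv i (hamiltonian μ β₁ β₂) z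

/-- The matrix `A = J Hess H` of the linearized equations at `z`. -/
def linearizationMatrix (μ β₁ β₂ : ℝ) (z : Fin 4 → ℝ) : Matrix (Fin 4) (Fin 4) ℝ :=
  symplecticJ * Matrix.of fun i j => partialDeriv i (partialDeriv j (hamiltonian μ β₁ β₂)) z

/-- Equilibrium solutions: the collision-free zeros of the Hamiltonian vector field. -/
def IsEquilibrium (μ β₁ β₂ : ℝ) (z : Fin 4 → ℝ) : Prop :=
  z ∈ phaseSpace μ ∧ hamiltonianField μ β₁ β₂ z = 0

/-- Triangular equilibrium solutions: those with `y ≠ 0`. -/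
def IsTriangularEquilibrium (μ β₁ β₂ : ℝ) (z : Fin 4 → ℝ) : Prop :=
  IsEquilibrium μ β₁ β₂ z ∧ z 1 ≠ 0

/-- The phase point with `p_x = -y`, `p_y = x`, that is, at rest in the rotating frame. -/
def restState (x y : ℝ) : Fin 4 → ℝ := ![x, y, -y, x]

/-- The collinear limits of the triangular equilibria, in which the triangle with sides
`β₁ ^ (1/3)`, `β₂ ^ (1/3)` and `1` degenerates to a segment (but both `β`'s stay positive). The
three cases are: left of both primaries, between them, right of both. -/
def IsCollinearLimit (μ β₁ β₂ : ℝ) (z : Fin 4 → ℝ) : Prop :=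
  0 < β₁ ∧ 0 < β₂ ∧
    ((β₂ ^ (1 / 3 : ℝ) - β₁ ^ (1 / 3 : ℝ) = 1 ∧ z = restState (-μ - β₁ ^ (1 / 3 : ℝ)) 0) ∨
     (β₁ ^ (1 / 3 : ℝ) + β₂ ^ (1 / 3 : ℝ) = 1 ∧ z = restState (-μ + β₁ ^ (1 / 3 : ℝ)) 0) ∨
     (β₁ ^ (1 / 3 : ℝ) - β₂ ^ (1 / 3 : ℝ) = 1 ∧ z = restState (-μ + β₁ ^ (1 / 3 : ℝ)) 0))

/-- `γ = γ₁ + γ₂`, where `γᵢ` is the angle at the `i`-th primary between the segment to the other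
primary and the segment to the third body. -/
def gammaAngle (μ : ℝ) (z : Fin 4 → ℝ) : ℝ :=
  let s₁ : EuclideanSpace ℝ (Fin 2) := !₂[-μ, 0]
  let s₂ : EuclideanSpace ℝ (Fin 2) := !₂[1 - μ, 0]
  let r : EuclideanSpace ℝ (Fin 2) := !₂[z 0, z 1]
  EuclideanGeometry.angle r s₁ s₂ + EuclideanGeometry.angle r s₂ s₁

/-- `F(μ, γ) = 1 - 36 μ (1 - μ) sin² γ`. -/
def stabilityF (μ γ : ℝ) : ℝ := 1 - 36 * μ * (1 - μ) * Real.sin γ ^ 2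

/-! ## Notions of stability for the equilibria -/

/-- Lyapunov stability of `z₀` for the full (nonlinear) equations of motion. -/
def IsStableEquilibrium (μ β₁ β₂ : ℝ) (z₀ : Fin 4 → ℝ) : Prop :=
  IsLyapunovStable (hamiltonianField μ β₁ β₂) (phaseSpace μ) z₀

/-- Linear stability of `z₀`: the zero solution of the linearized equation `ξ' = A ξ` is stable. -/
def IsLinearlyStable (μ β₁ β₂ : ℝ) (z₀ : Fin 4 → ℝ) : Prop :=
  IsLyapunovStable (linearizationMatrix μ β₁ β₂ z₀).mulVec Set.univ 0

/-- The complexification of the linearization matrix. -/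
def complexLinearization (μ β₁ β₂ : ℝ) (z₀ : Fin 4 → ℝ) : Matrix (Fin 4) (Fin 4) ℂ :=
  (linearizationMatrix μ β₁ β₂ z₀).map Complex.ofReal

/-- `A` is similar to a diagonal matrix. -/
def IsDiagonalizable (A : Matrix (Fin 4) (Fin 4) ℂ) : Prop :=
  ∃ (P : Matrix (Fin 4) (Fin 4) ℂ) (d : Fin 4 → ℂ),
    IsUnit P.det ∧ A = P * Matrix.diagonal d * P⁻¹

/-- `A` has an eigenvalue of algebraic multiplicity at least two. -/
def HasRepeatedEigenvalue (A : Matrix (Fin 4) (Fin 4) ℂ) : Prop :=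
  ∃ ev : ℂ, 2 ≤ A.charpoly.rootMultiplicity ev

end ChargedRestricted

end

/-! In both families of points the distances satisfy `ρᵢ ^ 3 = βᵢ` (`IsBalanced`). The charges then
drop out of the linearization: the Hessian of the effective potential is `3 ((1 - μ) u₁ u₁ᵀ + μ u₂
u₂ᵀ)`, where `uᵢ` is the unit vector from the `i`-th primary to the third body. Its trace is `3` and
its determinant is `c = 9 μ (1 - μ) sin² γ`, since `sin² γ` is the squared cross product of `u₁` and
`u₂`. Hence `A` has characteristic polynomial `λ⁴ + λ² + c`, and `F = 1 - 4 c` is its discriminant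
as a quadratic in `λ²`.

For `F < 0` the eigenvalues are `±a ± i b` with `a, b > 0`. A quadratic form then grows strictly
along the linear flow (`exists_growing_form`); it still grows along nonlinear solutions near `z`,
and it is positive somewhere, so some solutions are expelled (`not_isLyapunovStable_of_quadratic`).
Stability speaks only of solutions that are given, so instability also needs existence up to a
prescribed time; for this the field is replaced away from `z` by a bounded, globally Lipschitz one.

For `0 < F < 1` there are two distinct imaginary pairs, and a positive definite quadratic form is
conserved (`isLyapunovStable_of_imaginary`). At `F = 0` and `F = 1` the polynomial is `(λ² + 1/2)²`
and `λ² (λ² + 1)`; an explicit matrix entry shows that its squarefree part does not annihilate `A`.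
So there is a Jordan block, which yields an unbounded solution and excludes diagonalizability. -/

namespace ChargedRestricted

open Set Filter Topology Metric
open scoped NNReal

/-! ## Instability from a quadratic form that grows along the flow -/

/-- A bounded, globally Lipschitz autonomous field has solutions on every interval `[0, T]`. -/
theorem exists_isIntegralCurveOn_of_lipschitzWith {E : Type*} [NormedAddCommGroup E]
    [NormedSpace ℝ E] [CompleteSpace E] {Y : E → E} {K L : ℝ≥0} (hY : LipschitzWith K Y)
    (hL : ∀ x, ‖Y x‖ ≤ L) (x₀ : E) {T : ℝ} (hT : 0 ≤ T) :
    ∃ z : ℝ → E, z 0 = x₀ ∧ IsIntegralCurveOn z (fun _ => Y) (Icc 0 T) := by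
  -- A curve of speed at most `L` travels at most `L * T` by time `T`, so the ball of that radius is
  -- never left. The `0` is the radius of the set of initial points, here just `x₀`.
  have h : IsPicardLindelof (fun _ => Y) (tmin := 0) (tmax := T) ⟨0, le_refl _, hT⟩ x₀
      (L * T.toNNReal) 0 L K :=
    { lipschitzOnWith := fun t _ => hY.lipschitzOnWith
      continuousOn := fun x _ => continuousOn_const
      norm_le := fun t _ x _ => hL x
      mul_max_le := by simp [hT, NNReal.coe_mul] }
  exact h.exists_eq_forall_mem_Icc_hasDerivWithinAt₀

/-- A field that is Lipschitz near `p` agrees near `p` with a bounded Lipschitz field. -/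
theorem exists_lipschitzWith_eqOn_closedBall {ι : Type*} [Fintype ι]
    {X : (ι → ℝ) → (ι → ℝ)} {p : ι → ℝ} {K : ℝ≥0} {ε : ℝ} (hε : 0 ≤ ε)
    (hX : LipschitzOnWith K X (closedBall p ε)) :
    ∃ (Y : (ι → ℝ) → (ι → ℝ)) (L : ℝ≥0), LipschitzWith K Y ∧ (∀ x, ‖Y x‖ ≤ L) ∧
      EqOn Y X (closedBall p ε) := by
  -- Balls of the sup norm are boxes, so clamping each coordinate is a 1-Lipschitz retraction onto
  -- the ball.
  let c : (ι → ℝ) → (ι → ℝ) := fun x i => max (p i - ε) (min (x i) (p i + ε))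
  have hc : LipschitzWith 1 c := by
    refine LipschitzWith.of_dist_le_mul fun x y => ?_
    rw [NNReal.coe_one, one_mul, dist_pi_le_iff dist_nonneg]
    intro i
    refine le_trans ?_ (dist_le_pi_dist x y i)
    have h := (((LipschitzWith.id.min_const (p i + ε)).const_max (p i - ε)).dist_le_mul (x i) (y i))
    simpa using h
  have hcm : ∀ x, c x ∈ closedBall p ε := by
    intro x
    rw [mem_closedBall, dist_pi_le_iff hε]
    intro i
    rw [Real.dist_eq, abs_le]
    have h1 : p i - ε ≤ c x i := le_max_left _ _
    have h2 : c x i ≤ p i + ε := max_le (by linarith) (min_le_right _ _)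
    constructor <;> linarith
  have hce : ∀ x ∈ closedBall p ε, c x = x := by
    intro x hx
    rw [mem_closedBall, dist_pi_le_iff hε] at hx
    funext i
    have := hx i
    rw [Real.dist_eq, abs_le] at this
    simp only [c]
    rw [min_eq_left (by linarith), max_eq_right (by linarith)]
  have hp : p ∈ closedBall p ε := mem_closedBall_self hε
  refine ⟨X ∘ c, K * ε.toNNReal + ‖X p‖₊, ?_, ?_, ?_⟩
  · rw [← lipschitzOnWith_univ]
    simpa using hX.comp (hc.lipschitzOnWith (s := univ)) (fun x _ => hcm x)
  · intro x
    have h1 := hX.norm_sub_le (hcm x) hp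
    have h2 : ‖c x - p‖ ≤ ε := by simpa [dist_eq_norm] using hcm x
    have h3 : ‖X (c x)‖ ≤ ‖X (c x) - X p‖ + ‖X p‖ := by
      simpa using norm_add_le (X (c x) - X p) (X p)
    have h4 := mul_le_mul_of_nonneg_left h2 K.2
    simp only [Function.comp, NNReal.coe_add, NNReal.coe_mul, Real.coe_toNNReal _ hε, coe_nnnorm]
    change (K : ℝ) * _ ≤ K * ε at h4
    linarith
  · intro x hx
    simp [hce x hx]

/-- If `p` is stable, solutions of a field that agrees with `X` near `p` stay near `p`. -/
theorem norm_sub_lt_of_eqOn {E : Type*} [NormedAddCommGroup E] [NormedSpace ℝ E]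
    {X Y : E → E} {U : Set E} {p : E} {ε δ : ℝ}
    (hstab : ∀ T : ℝ, 0 ≤ T → ∀ z : ℝ → E, IsIntegralCurveOn z (fun _ => X) (Icc 0 T) →
      (∀ t ∈ Icc 0 T, z t ∈ U) → ‖z 0 - p‖ < δ → ∀ t ∈ Icc 0 T, ‖z t - p‖ < ε)
    (hU : closedBall p ε ⊆ U) (hXY : EqOn Y X (closedBall p ε)) {T : ℝ}
    {z : ℝ → E} (hz : IsIntegralCurveOn z (fun _ => Y) (Icc 0 T)) (h0 : ‖z 0 - p‖ < δ)
    (h0' : ‖z 0 - p‖ < ε) : ∀ t ∈ Icc 0 T, ‖z t - p‖ < ε := by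
  by_contra! hcon
  obtain ⟨t₁, ht₁, h₁⟩ := hcon
  have hcont : ContinuousOn (fun t => ‖z t - p‖) (Icc 0 T) :=
    fun t ht => ((hz t ht).continuousWithinAt.sub continuousWithinAt_const).norm
  have hcomp : IsCompact (Icc 0 T ∩ (fun t => ‖z t - p‖) ⁻¹' (Ici ε)) :=
    isCompact_Icc.of_isClosed_subset
      (hcont.preimage_isClosed_of_isClosed isClosed_Icc isClosed_Ici) inter_subset_left
  -- `τ` is the first time at distance at least `ε`. Up to `τ` the curve stays in the closed ball,
  -- so it also solves the equation for `X`, and stability at time `τ` gives a contradiction.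
  obtain ⟨τ, ⟨hτ, hτε⟩, hmin⟩ := hcomp.exists_isLeast ⟨t₁, ht₁, h₁⟩
  have hτ0 : 0 < τ := by
    rcases hτ.1.eq_or_lt with h | h
    · rw [← h] at hτε
      exact absurd h0' (not_lt.2 hτε)
    · exact h
  have hlt : ∀ t ∈ Ico 0 τ, ‖z t - p‖ ≤ ε := fun t ht => by
    by_contra! hc
    exact absurd (hmin ⟨⟨ht.1, ht.2.le.trans hτ.2⟩, hc.le⟩) (not_le.2 ht.2)
  have hsub : Icc 0 τ ⊆ Icc 0 T := Icc_subset_Icc_right hτ.2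
  have hle : ∀ t ∈ Icc 0 τ, ‖z t - p‖ ≤ ε := by
    have hcl : IsClosed (Icc 0 τ ∩ (fun t => ‖z t - p‖) ⁻¹' (Iic ε)) :=
      (hcont.mono hsub).preimage_isClosed_of_isClosed isClosed_Icc isClosed_Iic
    have hs : Ico 0 τ ⊆ Icc 0 τ ∩ (fun t => ‖z t - p‖) ⁻¹' (Iic ε) :=
      fun t ht => ⟨Ico_subset_Icc_self ht, hlt t ht⟩
    have := closure_minimal hs hcl
    rw [closure_Ico hτ0.ne] at this
    exact fun t ht => (this ht).2
  have hmem : ∀ t ∈ Icc 0 τ, z t ∈ closedBall p ε := fun t ht => by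
    simpa [dist_eq_norm] using hle t ht
  have hX : IsIntegralCurveOn z (fun _ => X) (Icc 0 τ) := fun t ht => by
    have := (hz t (hsub ht)).mono hsub
    simpa only [hXY (hmem t ht)] using this
  exact absurd (hstab τ hτ0.le z hX (fun t ht => hU (hmem t ht)) h0 τ ⟨hτ0.le, le_rfl⟩)
    (not_lt.2 hτε)

variable {E : Type*} [NormedAddCommGroup E] [NormedSpace ℝ E]

/-- A positive quadratic form on a finite-dimensional space is bounded below on the sphere. -/
theorem exists_pos_mul_sq_le [FiniteDimensional ℝ E] (B : E →L[ℝ] E →L[ℝ] ℝ) (A : E →L[ℝ] E)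
    (hpos : ∀ v, v ≠ 0 → 0 < B v (A v)) : ∃ m > 0, ∀ v, m * ‖v‖ ^ 2 ≤ B v (A v) := by
  have : ProperSpace E := FiniteDimensional.proper ℝ E
  have hcont : Continuous fun v => B v (A v) := by fun_prop
  rcases (sphere (0 : E) 1).eq_empty_or_nonempty with h | h
  · refine ⟨1, one_pos, fun v => ?_⟩
    have hv : v = 0 := by
      by_contra hv
      have : ‖v‖⁻¹ • v ∈ sphere (0 : E) 1 := by simp [norm_smul, hv]
      simp [h] at this
    simp [hv]
  · obtain ⟨w, hw, hmin⟩ := (isCompact_sphere (0 : E) 1).exists_isMinOn h hcont.continuousOn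
    have hw1 : ‖w‖ = 1 := by simpa using hw
    refine ⟨B w (A w), hpos w (by rintro rfl; simp at hw1), fun v => ?_⟩
    rcases eq_or_ne v 0 with rfl | hv
    · simp
    have hv' : ‖v‖ ≠ 0 := norm_ne_zero_iff.2 hv
    have h1 : B w (A w) ≤ B (‖v‖⁻¹ • v) (A (‖v‖⁻¹ • v)) := hmin (by simp [norm_smul, hv])
    simp only [map_smul, FunLike.coe_smul, Pi.smul_apply, smul_eq_mul] at h1
    have h2 := mul_le_mul_of_nonneg_right h1 (sq_nonneg ‖v‖)
    refine h2.trans_eq ?_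
    field_simp

/-- The nonlinear version of the growth estimate for a quadratic form. -/
theorem eventually_mul_sq_le {X : E → E} {p : E} {A : E →L[ℝ] E} (hX : HasFDerivAt X A p)
    (hp : X p = 0) (B : E →L[ℝ] E →L[ℝ] ℝ) {m : ℝ} (hm : 0 < m)
    (hB : ∀ v, m * ‖v‖ ^ 2 ≤ B v (A v)) :
    ∀ᶠ x in 𝓝 p, m / 2 * ‖x - p‖ ^ 2 ≤ B (x - p) (X x) := by
  -- Chosen so that the linearization error costs at most `m / 2` of the growth; the `+ 1` covers `B
  -- = 0`.
  have hη : 0 < m / (2 * (‖B‖ + 1)) := by positivity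
  filter_upwards [hX.isLittleO.def hη] with x hx
  rw [hp, sub_zero] at hx
  have h1 := hB (x - p)
  have h2 : |B (x - p) (X x - A (x - p))| ≤ ‖B‖ * ‖x - p‖ * (m / (2 * (‖B‖ + 1)) * ‖x - p‖) :=
    (B.le_opNorm₂ _ _).trans (by gcongr)
  have h3 : ‖B‖ * ‖x - p‖ * (m / (2 * (‖B‖ + 1)) * ‖x - p‖) ≤ m / 2 * ‖x - p‖ ^ 2 := by
    have : ‖B‖ * (m / (2 * (‖B‖ + 1))) ≤ m / 2 := by
      rw [mul_div_assoc', div_le_div_iff₀ (by positivity) two_pos]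
      nlinarith [norm_nonneg B]
    nlinarith [sq_nonneg ‖x - p‖]
  have h4 : B (x - p) (X x) = B (x - p) (A (x - p)) + B (x - p) (X x - A (x - p)) := by
    rw [← map_add]; simp
  have h5 := (abs_le.1 (h2.trans h3)).1
  linarith

/-- If some indefinite or positive quadratic form `B` strictly increases along the linearized flow,
the equilibrium is unstable. -/
theorem not_isLyapunovStable_of_quadratic {ι : Type*} [Fintype ι] {X : (ι → ℝ) → (ι → ℝ)}
    {U : Set (ι → ℝ)} {p : ι → ℝ} {A : (ι → ℝ) →L[ℝ] (ι → ℝ)} (hU : U ∈ 𝓝 p)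
    (hX : HasStrictFDerivAt X A p) (hp : X p = 0) (B : (ι → ℝ) →L[ℝ] (ι → ℝ) →L[ℝ] ℝ)
    (hsymm : ∀ v w, B v w = B w v) (hpos : ∀ v, v ≠ 0 → 0 < B v (A v))
    {v₀ : ι → ℝ} (hv₀ : 0 < B v₀ v₀) : ¬ IsLyapunovStable X U p := by
  intro hstab
  obtain ⟨m, hm, hB⟩ := exists_pos_mul_sq_le B A hpos
  obtain ⟨K, s, hs, hK⟩ := hX.exists_lipschitzOnWith
  obtain ⟨ε, hε, hball⟩ := Metric.nhds_basis_closedBall.mem_iff.1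
    (inter_mem (inter_mem hU hs) (eventually_mul_sq_le hX.hasFDerivAt hp B hm hB))
  obtain ⟨δ, hδ, hst⟩ := hstab ε hε
  obtain ⟨Y, L, hYK, hYL, hYX⟩ := exists_lipschitzWith_eqOn_closedBall hε.le
    (hK.mono fun x hx => (hball hx).1.2)
  have hb : 0 < ‖B‖ := (norm_nonneg B).lt_of_ne fun h => by
    have h1 := B.le_opNorm₂ v₀ v₀
    rw [← h, zero_mul, zero_mul, norm_le_zero_iff] at h1
    exact hv₀.ne' h1
  set k : ℝ := min δ ε / (‖v₀‖ + 1) with hk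
  have hkpos : 0 < k := by positivity
  have hnorm : ‖k • v₀‖ < min δ ε := by
    rw [norm_smul, Real.norm_of_nonneg hkpos.le, hk, div_mul_eq_mul_div,
      div_lt_iff₀ (by positivity)]
    have : 0 < min δ ε := lt_min hδ hε
    nlinarith [norm_nonneg v₀]
  set q : ℝ := B (k • v₀) (k • v₀) with hq
  have hqpos : 0 < q := by
    simp only [hq, map_smul, FunLike.coe_smul, Pi.smul_apply, smul_eq_mul]
    positivity
  -- growth rate of the form
  set c : ℝ := m * (q / ‖B‖) with hc
  have hcpos : 0 < c := by positivity
  -- Growth at rate at least `c` for time `T` lifts the form from `q` to at least `q + ‖B‖ ε²`, more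
  -- than its bound `‖B‖ ε²` on the ball.
  set T : ℝ := ‖B‖ * ε ^ 2 / c with hT
  have hTnn : 0 ≤ T := by positivity
  obtain ⟨z, hz0, hz⟩ := exists_isIntegralCurveOn_of_lipschitzWith hYK hYL (p + k • v₀) hTnn
  have hz0' : z 0 - p = k • v₀ := by simp [hz0]
  have hzlt := norm_sub_lt_of_eqOn hst (fun x hx => (hball hx).1.1) hYX hz
    (by rw [hz0']; exact hnorm.trans_le (min_le_left _ _))
    (by rw [hz0']; exact hnorm.trans_le (min_le_right _ _))
  have hmem : ∀ t ∈ Icc 0 T, z t ∈ closedBall p ε := fun t ht => by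
    simpa [dist_eq_norm] using (hzlt t ht).le
  let f : ℝ → ℝ := fun t => B (z t - p) (z t - p)
  have hderiv : ∀ t ∈ Icc 0 T, HasDerivWithinAt f (2 * B (z t - p) (X (z t))) (Icc 0 T) t := by
    intro t ht
    have h1 : HasDerivWithinAt (fun t => z t - p) (X (z t)) (Icc 0 T) t := by
      rw [← hYX (hmem t ht)]
      exact (hz t ht).sub_const p
    have h2 := (B.hasFDerivAt.comp_hasDerivWithinAt t h1).clm_apply h1
    refine h2.congr_deriv ?_
    simp only [Function.comp]
    rw [hsymm (X (z t))]; ring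
  have hcontf : ContinuousOn f (Icc 0 T) := fun t ht => (hderiv t ht).continuousWithinAt
  have hd : ∀ t ∈ Icc 0 T, m * ‖z t - p‖ ^ 2 ≤ 2 * B (z t - p) (X (z t)) := fun t ht => by
    have := (hball (hmem t ht)).2
    simp only [mem_ofPred_eq] at this
    linarith
  have hle : ∀ t ∈ Icc 0 T, f t ≤ ‖B‖ * ‖z t - p‖ ^ 2 := fun t ht => by
    have := (le_abs_self _).trans (B.le_opNorm₂ (z t - p) (z t - p))
    calc f t ≤ _ := this
      _ = _ := by ring
  have hint : interior (Icc (0 : ℝ) T) ⊆ Icc 0 T := interior_subset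
  have hda : ∀ t ∈ interior (Icc (0 : ℝ) T), HasDerivAt f (2 * B (z t - p) (X (z t))) t :=
    fun t ht => (hderiv t (hint ht)).hasDerivAt (mem_interior_iff_mem_nhds.1 ht)
  -- Monotonicity keeps `f ≥ q`, so `‖z t - p‖ ^ 2 ≥ q / ‖B‖`: the solution stays away from `p`, and
  -- the derivative of `f` is bounded below by `c`.
  have hmono : MonotoneOn f (Icc 0 T) :=
    monotoneOn_of_deriv_nonneg (convex_Icc 0 T) hcontf
      (fun t ht => (hda t ht).differentiableAt.differentiableWithinAt)
      (fun t ht => by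
        rw [(hda t ht).deriv]
        exact le_trans (by positivity) (hd t (hint ht)))
  have hf0 : f 0 = q := by simp only [f, hz0', hq]
  have h0T : (0 : ℝ) ∈ Icc 0 T := ⟨le_rfl, hTnn⟩
  have hTT : T ∈ Icc 0 T := ⟨hTnn, le_rfl⟩
  have hlow := (convex_Icc 0 T).mul_sub_le_image_sub_of_le_deriv hcontf
    (fun t ht => (hda t ht).differentiableAt.differentiableWithinAt) (C := c)
    (fun t ht => by
      rw [(hda t ht).deriv]
      refine le_trans ?_ (hd t (hint ht))
      rw [hc]
      refine mul_le_mul_of_nonneg_left ?_ hm.le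
      rw [div_le_iff₀' hb]
      exact (hf0 ▸ hmono h0T (hint ht) (hint ht).1).trans (hle t (hint ht))) 0 h0T T hTT hTnn
  rw [sub_zero, hf0, hT, mul_div_cancel₀ _ hcpos.ne', ← hT] at hlow
  have h1 := hle T hTT
  have h2 : ‖z T - p‖ ^ 2 ≤ ε ^ 2 := by
    have := (hzlt T hTT).le
    gcongr
  nlinarith

end ChargedRestricted

namespace ChargedRestricted

open Set Filter Topology Metric Polynomial Matrix

/-! ## Diagonalizable matrices -/

theorem aeval_conj_diagonal {P : Matrix (Fin 4) (Fin 4) ℂ} (hP : IsUnit P.det) (d : Fin 4 → ℂ)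
    (f : ℂ[X]) : aeval (P * diagonal d * P⁻¹) f = P * diagonal (fun i => f.eval (d i)) * P⁻¹ := by
  have hPP : P⁻¹ * P = 1 := Matrix.nonsing_inv_mul P hP
  have hPP' : P * P⁻¹ = 1 := Matrix.mul_nonsing_inv P hP
  induction f using Polynomial.induction_on' with
  | add f g hf hg =>
    simp only [map_add, hf, hg, eval_add, ← Matrix.add_mul, ← Matrix.mul_add, diagonal_add]
  | monomial n a =>
    have hpow : ∀ n : ℕ, (P * diagonal d * P⁻¹) ^ n = P * diagonal (fun i => d i ^ n) * P⁻¹ := by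
      intro n
      induction n with
      | zero => simp [hPP']
      | succ n ih =>
        rw [pow_succ, ih]
        calc P * diagonal (fun i => d i ^ n) * P⁻¹ * (P * diagonal d * P⁻¹)
            = P * diagonal (fun i => d i ^ n) * (P⁻¹ * P) * diagonal d * P⁻¹ := by
              simp only [Matrix.mul_assoc]
          _ = _ := by
              rw [hPP, Matrix.mul_one, Matrix.mul_assoc P, diagonal_mul_diagonal]
              simp only [pow_succ]
    rw [aeval_monomial, hpow, ← Algebra.smul_def, ← Matrix.smul_mul, ← Matrix.mul_smul,
      ← diagonal_smul]
    congr 3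
    funext i
    simp

/-- A polynomial in a diagonalizable matrix is zero as soon as its square is. -/
theorem IsDiagonalizable.aeval_eq_zero {A : Matrix (Fin 4) (Fin 4) ℂ} (hA : IsDiagonalizable A)
    {f : ℂ[X]} (hf : aeval A (f ^ 2) = 0) : aeval A f = 0 := by
  obtain ⟨P, d, hP, rfl⟩ := hA
  have hPP : P⁻¹ * P = 1 := Matrix.nonsing_inv_mul P hP
  rw [aeval_conj_diagonal hP] at hf ⊢
  have h : diagonal (fun i => (f ^ 2).eval (d i)) = 0 := by
    have := congrArg (fun M => P⁻¹ * M * P) hf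
    simpa [Matrix.mul_assoc, hPP, ← Matrix.mul_assoc P⁻¹ P] using this
  have h0 : (fun i => f.eval (d i)) = 0 := by
    funext i
    have := congrFun (congrFun h i) i
    simpa using this
  simp [h0]

theorem hasRepeatedEigenvalue_of_dvd {A : Matrix (Fin 4) (Fin 4) ℂ} {a : ℂ}
    (h : (X - C a) ^ 2 ∣ A.charpoly) : HasRepeatedEigenvalue A :=
  ⟨a, (le_rootMultiplicity_iff A.charpoly_monic.ne_zero).2 h⟩

/-! ## Stability of linear systems -/

/-- An unbounded solution of a linear system makes it unstable. -/
theorem not_isLyapunovStable_of_unbounded {n : Type*} [Fintype n] {A : Matrix n n ℝ}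
    {z : ℝ → n → ℝ} (hz : ∀ t, HasDerivAt z (A *ᵥ z t) t)
    (hun : ∀ R : ℝ, ∃ t : ℝ, 0 ≤ t ∧ R ≤ ‖z t‖) : ¬ IsLyapunovStable A.mulVec univ 0 := by
  intro h
  obtain ⟨δ, hδ, hst⟩ := h 1 one_pos
  -- By linearity `k • z` is a solution; it starts within `δ` and reaches norm `1` once `‖z t‖ ≥
  -- k⁻¹`.
  set k : ℝ := δ / (‖z 0‖ + 1) with hk
  have hkpos : 0 < k := by positivity
  obtain ⟨t, ht0, ht⟩ := hun k⁻¹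
  have := hst t ht0 (fun s => k • z s) (fun s _ => by
    have := ((hz s).const_smul k).hasDerivWithinAt (s := Icc 0 t)
    rw [← Matrix.mulVec_smul] at this
    exact this) (fun _ _ => mem_univ _) (by
      rw [sub_zero, norm_smul, Real.norm_of_nonneg hkpos.le, hk, div_mul_eq_mul_div,
        div_lt_iff₀ (by positivity)]
      nlinarith [norm_nonneg (z 0)]) t ⟨ht0, le_rfl⟩
  rw [sub_zero, norm_smul, Real.norm_of_nonneg hkpos.le] at this
  have h2 := mul_le_mul_of_nonneg_left ht hkpos.le
  rw [mul_inv_cancel₀ hkpos.ne'] at h2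
  linarith

/-- A nontrivial Jordan block at the eigenvalue `0` makes a linear system unstable. -/
theorem not_isLyapunovStable_of_jordan_zero {n : Type*} [Fintype n] {A : Matrix n n ℝ}
    {v : n → ℝ} (hv : A *ᵥ v ≠ 0) (hv2 : A *ᵥ (A *ᵥ v) = 0) :
    ¬ IsLyapunovStable A.mulVec univ 0 := by
  refine not_isLyapunovStable_of_unbounded (z := fun t => v + t • (A *ᵥ v)) (fun t => ?_)
    (fun R => ?_)
  · have := ((hasDerivAt_id t).smul_const (A *ᵥ v)).const_add v
    simpa [Matrix.mulVec_add, Matrix.mulVec_smul, hv2] using this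
  · have hpos : 0 < ‖A *ᵥ v‖ := norm_pos_iff.2 hv
    refine ⟨(|R| + ‖v‖) / ‖A *ᵥ v‖, by positivity, ?_⟩
    set t := (|R| + ‖v‖) / ‖A *ᵥ v‖ with ht
    have htn : ‖t • (A *ᵥ v)‖ = |R| + ‖v‖ := by
      rw [norm_smul, Real.norm_of_nonneg (by positivity), ht, div_mul_cancel₀ _ hpos.ne']
    have h1 : ‖t • (A *ᵥ v)‖ ≤ ‖v + t • (A *ᵥ v)‖ + ‖v‖ := by
      simpa using norm_sub_le (v + t • (A *ᵥ v)) v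
    linarith [le_abs_self R]

/-- A nontrivial Jordan block at a pair of imaginary eigenvalues makes a linear system unstable. -/
theorem not_isLyapunovStable_of_jordan_imaginary {n : Type*} [Fintype n] {A : Matrix n n ℝ} {ω : ℝ}
    (hω : 0 < ω) {v w : n → ℝ} (hv : A *ᵥ (A *ᵥ v) = w - ω ^ 2 • v)
    (hw : A *ᵥ (A *ᵥ w) = -ω ^ 2 • w) (hw0 : w ≠ 0) :
    ¬ IsLyapunovStable A.mulVec univ 0 := by
  have hAw : A *ᵥ w ≠ 0 := by
    intro h
    rw [h, Matrix.mulVec_zero] at hw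
    exact (smul_ne_zero (neg_ne_zero.2 (pow_ne_zero 2 hω.ne')) hw0) hw.symm
  have hpos : 0 < ‖A *ᵥ w‖ := norm_pos_iff.2 hAw
  -- This is the solution starting at `v`, written in the invariant span of `v, A v, w, A w`; the
  -- resonance produces the terms linear in `t`.
  refine not_isLyapunovStable_of_unbounded
    (z := fun t => Real.cos (ω * t) • v + (Real.sin (ω * t) / ω) • (A *ᵥ v) +
      (t * Real.sin (ω * t) / (2 * ω)) • w +
      (Real.sin (ω * t) / (2 * ω ^ 3) - t * Real.cos (ω * t) / (2 * ω ^ 2)) • (A *ᵥ w))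
    (fun t => ?_) (fun R => ?_)
  · have hl : HasDerivAt (fun t => ω * t) ω t := by simpa using (hasDerivAt_id t).const_mul ω
    have hs := hl.sin
    have hc := hl.cos
    have ha := hc.smul_const v
    have hb := (hs.div_const ω).smul_const (A *ᵥ v)
    have hcc := (((hasDerivAt_id t).mul hs).div_const (2 * ω)).smul_const w
    have hd := ((hs.div_const (2 * ω ^ 3)).sub
      (((hasDerivAt_id t).mul hc).div_const (2 * ω ^ 2))).smul_const (A *ᵥ w)
    have := ((ha.add hb).add hcc).add hd
    refine this.congr_deriv ?_
    simp only [Matrix.mulVec_add, Matrix.mulVec_smul, hv, hw, id]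
    funext i
    simp only [Pi.add_apply, Pi.smul_apply, Pi.sub_apply, smul_eq_mul]
    field_simp
    ring
  · obtain ⟨k, hk⟩ := exists_nat_ge ((|R| + ‖v‖) * ω ^ 3 / (Real.pi * ‖A *ᵥ w‖))
    have hωt : ω * (k * (2 * Real.pi) / ω) = k * (2 * Real.pi) := by field_simp
    refine ⟨k * (2 * Real.pi) / ω, by positivity, ?_⟩
    have hs : Real.sin (k * (2 * Real.pi)) = 0 := by
      simpa using Real.sin_add_nat_mul_two_pi 0 k
    simp only [hωt, hs, Real.cos_nat_mul_two_pi]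
    have hz : (k * (2 * Real.pi) / ω * 1 / (2 * ω ^ 2)) = k * Real.pi / ω ^ 3 := by
      field_simp
    simp only [hz, one_smul, zero_div, zero_smul, mul_zero, add_zero, zero_sub, neg_smul]
    rw [← sub_eq_add_neg]
    have h1 : ‖(k * Real.pi / ω ^ 3) • (A *ᵥ w)‖ ≤
        ‖v - (k * Real.pi / ω ^ 3) • (A *ᵥ w)‖ + ‖v‖ := by
      have := norm_sub_le v (v - (k * Real.pi / ω ^ 3) • (A *ᵥ w))
      rw [sub_sub_cancel] at this
      linarith
    rw [norm_smul, Real.norm_of_nonneg (by positivity)] at h1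
    rw [div_le_iff₀ (by positivity)] at hk
    have h2 : |R| + ‖v‖ ≤ k * Real.pi / ω ^ 3 * ‖A *ᵥ w‖ := by
      rw [div_mul_eq_mul_div, le_div_iff₀ (by positivity)]
      linarith
    linarith [le_abs_self R]

theorem hasDerivWithinAt_dotProduct_self {n : Type*} [Fintype n] {f : ℝ → n → ℝ} {f' : n → ℝ}
    {s : Set ℝ} {t : ℝ} (hf : HasDerivWithinAt f f' s t) :
    HasDerivWithinAt (fun t => f t ⬝ᵥ f t) (2 * (f t ⬝ᵥ f')) s t := by
  have h := hasDerivWithinAt_pi.1 hf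
  have := HasDerivWithinAt.fun_sum (u := Finset.univ) fun i _ => (h i).mul (h i)
  refine this.congr_deriv ?_
  rw [dotProduct, Finset.mul_sum]
  exact Finset.sum_congr rfl fun i _ => by ring

theorem hasDerivWithinAt_mulVec {n : Type*} [Fintype n] (M : Matrix n n ℝ) {f : ℝ → n → ℝ}
    {f' : n → ℝ} {s : Set ℝ} {t : ℝ} (hf : HasDerivWithinAt f f' s t) :
    HasDerivWithinAt (fun t => M *ᵥ f t) (M *ᵥ f') s t :=
  (M.mulVecLin.toContinuousLinearMap.hasFDerivAt (x := f t)).comp_hasDerivWithinAt t hf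

/-- The energy of a component with frequency `√k` is conserved. -/
theorem oscillator_energy_const {n : Type*} [Fintype n] {A : Matrix n n ℝ} {k T : ℝ}
    {P : Matrix n n ℝ} (hPA : A * A * P = -k • P) (hcomm : P * A = A * P)
    {z : ℝ → n → ℝ} (hz : IsIntegralCurveOn z (fun _ => A.mulVec) (Icc 0 T)) :
    ∀ t ∈ Icc 0 T, ((A * P) *ᵥ z t) ⬝ᵥ ((A * P) *ᵥ z t) + k * ((P *ᵥ z t) ⬝ᵥ (P *ᵥ z t)) =
      ((A * P) *ᵥ z 0) ⬝ᵥ ((A * P) *ᵥ z 0) + k * ((P *ᵥ z 0) ⬝ᵥ (P *ᵥ z 0)) := by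
  have hd : ∀ t ∈ Icc 0 T, HasDerivWithinAt (fun t => ((A * P) *ᵥ z t) ⬝ᵥ ((A * P) *ᵥ z t) +
      k * ((P *ᵥ z t) ⬝ᵥ (P *ᵥ z t))) 0 (Icc 0 T) t := by
    intro t ht
    have h1 := hasDerivWithinAt_dotProduct_self (hasDerivWithinAt_mulVec (A * P) (hz t ht))
    have h2 := hasDerivWithinAt_dotProduct_self (hasDerivWithinAt_mulVec P (hz t ht))
    refine (h1.add (h2.const_mul k)).congr_deriv ?_
    have e1 : (A * P) *ᵥ A *ᵥ z t = -k • (P *ᵥ z t) := by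
      rw [Matrix.mulVec_mulVec, Matrix.mul_assoc, hcomm, ← Matrix.mul_assoc, hPA,
        Matrix.smul_mulVec]
    have e2 : P *ᵥ A *ᵥ z t = (A * P) *ᵥ z t := by rw [Matrix.mulVec_mulVec, hcomm]
    rw [e1, e2, dotProduct_smul, dotProduct_comm (P *ᵥ z t), smul_eq_mul]
    ring
  refine constant_of_derivWithin_zero (fun t ht => (hd t ht).differentiableWithinAt) fun t ht => ?_
  have hlt : (0 : ℝ) < T := ht.1.trans_lt ht.2
  exact (hd t (Ico_subset_Icc_self ht)).derivWithin
    ((uniqueDiffOn_Icc hlt) t (Ico_subset_Icc_self ht))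

theorem norm_sq_le_dotProduct_self {n : Type*} [Fintype n] (v : n → ℝ) : ‖v‖ ^ 2 ≤ v ⬝ᵥ v := by
  have h : ‖v‖ ≤ √(v ⬝ᵥ v) := by
    refine (pi_norm_le_iff_of_nonneg (Real.sqrt_nonneg _)).2 fun i => ?_
    rw [Real.norm_eq_abs]
    refine Real.abs_le_sqrt ?_
    rw [pow_two]
    exact Finset.single_le_sum (f := fun i => v i * v i) (fun i _ => mul_self_nonneg _)
      (Finset.mem_univ i)
  have h0 : 0 ≤ v ⬝ᵥ v := Finset.sum_nonneg fun i _ => mul_self_nonneg _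
  calc ‖v‖ ^ 2 ≤ √(v ⬝ᵥ v) ^ 2 := by gcongr
    _ = _ := Real.sq_sqrt h0

/-- Two distinct pairs of simple imaginary eigenvalues give a stable linear system. -/
theorem isLyapunovStable_of_imaginary {n : Type*} [Fintype n] [DecidableEq n] {A : Matrix n n ℝ}
    {k l : ℝ} (hk : 0 < k) (hl : 0 < l) (hkl : k ≠ l)
    (hA : (A * A + k • 1) * (A * A + l • 1) = 0) : IsLyapunovStable A.mulVec univ 0 := by
  set P := A * A + l • (1 : Matrix n n ℝ) with hP
  set Q := A * A + k • (1 : Matrix n n ℝ) with hQ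
  have hPQ : P * Q = 0 := by
    rw [← hA, hP, hQ]; simp [Matrix.add_mul, Matrix.mul_add, smul_smul, mul_comm]; abel
  have hPA : A * A * P = -k • P := by
    have : A * A = Q - k • 1 := by simp [hQ]
    rw [this, Matrix.sub_mul, hA]; simp
  have hQA : A * A * Q = -l • Q := by
    have : A * A = P - l • 1 := by simp [hP]
    rw [this, Matrix.sub_mul, hPQ]; simp
  have hPc : P * A = A * P := by simp [hP, Matrix.add_mul, Matrix.mul_add, Matrix.mul_assoc]
  have hQc : Q * A = A * Q := by simp [hQ, Matrix.add_mul, Matrix.mul_add, Matrix.mul_assoc]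
  -- `P` and `Q` are, up to scaling, the projections onto the two oscillators, and `V` adds their
  -- energies. As `Q - P = (k - l) • 1`, no nonzero vector is killed by both, so `V` is positive
  -- definite.
  let V : (n → ℝ) → ℝ := fun x => (((A * P) *ᵥ x) ⬝ᵥ ((A * P) *ᵥ x) + k * ((P *ᵥ x) ⬝ᵥ (P *ᵥ x))) +
    (((A * Q) *ᵥ x) ⬝ᵥ ((A * Q) *ᵥ x) + l * ((Q *ᵥ x) ⬝ᵥ (Q *ᵥ x)))
  have hVcont : Continuous V := by fun_prop
  have hlow : ∀ (R : Matrix n n ℝ) (m : ℝ), 0 < m → ∀ x, m * ‖R *ᵥ x‖ ^ 2 ≤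
      ((A * R) *ᵥ x) ⬝ᵥ ((A * R) *ᵥ x) + m * ((R *ᵥ x) ⬝ᵥ (R *ᵥ x)) := by
    intro R m hm x
    have h1 : 0 ≤ ((A * R) *ᵥ x) ⬝ᵥ ((A * R) *ᵥ x) :=
      Finset.sum_nonneg fun i _ => mul_self_nonneg _
    have h2 := mul_le_mul_of_nonneg_left (norm_sq_le_dotProduct_self (R *ᵥ x)) hm.le
    linarith
  have hVlow : ∀ x, (min k l * |k - l| ^ 2 / 2) * ‖x‖ ^ 2 ≤ V x := by
    intro x
    have h1 := hlow P k hk x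
    have h2 := hlow Q l hl x
    have h3 : Q *ᵥ x - P *ᵥ x = (k - l) • x := by
      rw [← Matrix.sub_mulVec, hP, hQ, add_sub_add_left_eq_sub, ← sub_smul, Matrix.smul_mulVec,
        Matrix.one_mulVec]
    have h4 : |k - l| * ‖x‖ ≤ ‖Q *ᵥ x‖ + ‖P *ᵥ x‖ := by
      rw [← Real.norm_eq_abs, ← norm_smul, ← h3]
      exact norm_sub_le _ _
    have h5 : (|k - l| * ‖x‖) ^ 2 ≤ 2 * (‖Q *ᵥ x‖ ^ 2 + ‖P *ᵥ x‖ ^ 2) := by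
      have := pow_le_pow_left₀ (by positivity) h4 2
      nlinarith [sq_nonneg (‖Q *ᵥ x‖ - ‖P *ᵥ x‖)]
    have h6 := mul_le_mul_of_nonneg_right (min_le_left k l) (sq_nonneg ‖P *ᵥ x‖)
    have h7 := mul_le_mul_of_nonneg_right (min_le_right k l) (sq_nonneg ‖Q *ᵥ x‖)
    have h8 : 0 ≤ min k l := (lt_min hk hl).le
    have h9 := mul_le_mul_of_nonneg_left h5 h8
    simp only [V]
    nlinarith
  intro ε hε
  have hm : 0 < min k l * |k - l| ^ 2 / 2 := by
    have := abs_pos.2 (sub_ne_zero.2 hkl)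
    have := lt_min hk hl
    positivity
  set m := min k l * |k - l| ^ 2 / 2
  have hV0 : V 0 = 0 := by simp [V]
  have hev : ∀ᶠ x in 𝓝 (0 : n → ℝ), V x < m * ε ^ 2 :=
    hVcont.continuousAt.eventually_lt_const (by rw [hV0]; positivity)
  obtain ⟨δ, hδ, hball⟩ := Metric.eventually_nhds_iff.1 hev
  refine ⟨δ, hδ, fun T hT z hz _ h0 t ht => ?_⟩
  have hconst : V (z t) = V (z 0) := by
    simp only [V]
    rw [oscillator_energy_const hPA hPc hz t ht, oscillator_energy_const hQA hQc hz t ht]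
  have h1 : V (z 0) < m * ε ^ 2 := hball (by simpa [dist_eq_norm] using h0)
  have h2 := hVlow (z t)
  rw [sub_zero]
  have h3 : ‖z t‖ ^ 2 < ε ^ 2 := lt_of_mul_lt_mul_left ((h2.trans_eq hconst).trans_lt h1) hm.le
  exact lt_of_pow_lt_pow_left₀ 2 hε.le h3

end ChargedRestricted

namespace ChargedRestricted

open Set Filter Topology Metric Polynomial Matrix

/-! ## A quadratic form growing along a linear flow with four complex eigenvalues -/

/-- The form `v, w ↦ (M v) ⬝ (M w)`. -/
noncomputable def gramForm {n : Type*} [Fintype n] (M : Matrix n n ℝ) :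
    (n → ℝ) →L[ℝ] (n → ℝ) →L[ℝ] ℝ :=
  LinearMap.toContinuousBilinearMap <| LinearMap.mk₂ ℝ (fun v w => (M *ᵥ v) ⬝ᵥ (M *ᵥ w))
    (fun v v' w => by simp [Matrix.mulVec_add]) (fun c v w => by simp [Matrix.mulVec_smul])
    (fun v w w' => by simp [Matrix.mulVec_add]) (fun c v w => by simp [Matrix.mulVec_smul])

theorem gramForm_apply {n : Type*} [Fintype n] (M : Matrix n n ℝ) (v w : n → ℝ) :
    gramForm M v w = (M *ᵥ v) ⬝ᵥ (M *ᵥ w) := rfl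

theorem gramForm_nonneg {n : Type*} [Fintype n] (M : Matrix n n ℝ) (v : n → ℝ) :
    0 ≤ gramForm M v v := Finset.sum_nonneg fun _ _ => mul_self_nonneg _

theorem gramForm_pos {n : Type*} [Fintype n] {M : Matrix n n ℝ} {v : n → ℝ} (h : M *ᵥ v ≠ 0) :
    0 < gramForm M v v :=
  (gramForm_nonneg M v).lt_of_ne fun h0 => h (dotProduct_self_eq_zero.1 h0.symm)

/-- On the range of a matrix `P` commuting with `A` on which `A` has eigenvalues `a ± i b`,
this form is multiplied by `exp (2 a t)` under the flow of `A`. -/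
noncomputable def focusForm {n : Type*} [Fintype n] [DecidableEq n] (A P : Matrix n n ℝ) (a b : ℝ) :
    (n → ℝ) →L[ℝ] (n → ℝ) →L[ℝ] ℝ :=
  b ^ 2 • gramForm P + gramForm (A * P - a • P)

theorem focusForm_symm {n : Type*} [Fintype n] [DecidableEq n] (A P : Matrix n n ℝ) (a b : ℝ)
    (v w : n → ℝ) : focusForm A P a b v w = focusForm A P a b w v := by
  simp [focusForm, gramForm_apply, dotProduct_comm]

/-- With `x = P v` and `y = (A - a) P v`, applying `A` to `v` sends `(x, y)` to `(a x + y, a y - b²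
x)`. Weighting `x` by `b²` makes the cross terms cancel and leaves the factor `a`. -/
theorem focusForm_mulVec {n : Type*} [Fintype n] [DecidableEq n] {A P : Matrix n n ℝ} {a b : ℝ}
    (hc : P * A = A * P) (hP : A * A * P = (2 * a) • (A * P) - (a ^ 2 + b ^ 2) • P) (v : n → ℝ) :
    focusForm A P a b v (A *ᵥ v) = a * focusForm A P a b v v := by
  have e1 : P *ᵥ A *ᵥ v = a • (P *ᵥ v) + (A * P - a • P) *ᵥ v := by
    rw [Matrix.mulVec_mulVec, hc, Matrix.sub_mulVec, Matrix.smul_mulVec]; abel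
  have e2 : (A * P - a • P) *ᵥ A *ᵥ v = a • ((A * P - a • P) *ᵥ v) - b ^ 2 • (P *ᵥ v) := by
    rw [Matrix.mulVec_mulVec, Matrix.sub_mul, Matrix.smul_mul, Matrix.mul_assoc, hc,
      ← Matrix.mul_assoc, hP]
    simp only [Matrix.sub_mulVec, Matrix.smul_mulVec]
    module
  simp only [focusForm, _root_.add_apply, FunLike.coe_smul, Pi.smul_apply, gramForm_apply, e1, e2,
    dotProduct_add, dotProduct_sub, dotProduct_smul, smul_eq_mul,
    dotProduct_comm ((A * P - a • P) *ᵥ v) (P *ᵥ v)]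
  ring

/-- The eigenvalues `±a ± i b` with `a > 0` give a form strictly growing along the flow. -/
theorem exists_growing_form {n : Type*} [Fintype n] [DecidableEq n] {A : Matrix n n ℝ} {a b : ℝ}
    (ha : 0 < a) (hb : 0 < b) (hinj : ∀ v, A *ᵥ v = 0 → v = 0)
    (hA : (A * A - (2 * a) • A + (a ^ 2 + b ^ 2) • 1) *
      (A * A + (2 * a) • A + (a ^ 2 + b ^ 2) • 1) = 0)
    (hne : A * A + (2 * a) • A + (a ^ 2 + b ^ 2) • 1 ≠ 0) :
    ∃ B : (n → ℝ) →L[ℝ] (n → ℝ) →L[ℝ] ℝ, (∀ v w, B v w = B w v) ∧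
      (∀ v, v ≠ 0 → 0 < B v (A *ᵥ v)) ∧ ∃ v₀, 0 < B v₀ v₀ := by
  set r := a ^ 2 + b ^ 2 with hr
  set P := A * A + (2 * a) • A + r • (1 : Matrix n n ℝ) with hP
  set N := A * A - (2 * a) • A + r • (1 : Matrix n n ℝ) with hN
  have hPc : P * A = A * P := by
    simp [hP, Matrix.add_mul, Matrix.mul_add, Matrix.mul_assoc]
  have hNc : N * A = A * N := by
    simp [hN, Matrix.add_mul, Matrix.mul_add, Matrix.sub_mul, Matrix.mul_sub, Matrix.mul_assoc]
  have hNP : P * N = 0 := by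
    have hPA : Commute P A := hPc
    have hPN : Commute P N := ((hPA.mul_right hPA).sub_right (hPA.smul_right _)).add_right
      ((Commute.one_right P).smul_right r)
    rw [hPN.eq, hA]
  have hAAP : A * A * P = (2 * a) • (A * P) - (a ^ 2 + b ^ 2) • P := by
    have : A * A = N + (2 * a) • A - r • 1 := by rw [hN]; abel
    rw [this, Matrix.sub_mul, Matrix.add_mul, hA]; simp [hr]
  have hAAN : A * A * N = (2 * -a) • (A * N) - ((-a) ^ 2 + b ^ 2) • N := by
    have : A * A = P - (2 * a) • A - r • 1 := by rw [hP]; abel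
    rw [this, Matrix.sub_mul, Matrix.sub_mul, hNP]; simp [hr]
  have hdiff : ∀ v, P *ᵥ v - N *ᵥ v = (4 * a) • (A *ᵥ v) := by
    intro v
    rw [← Matrix.sub_mulVec, ← Matrix.smul_mulVec, hP, hN]
    congr 1
    module
  have hnn : ∀ (R : Matrix n n ℝ) (α : ℝ) v, 0 ≤ focusForm A R α b v v := fun R α v => by
    have := gramForm_nonneg R v
    have := gramForm_nonneg (A * R - α • R) v
    simp only [focusForm, _root_.add_apply, FunLike.coe_smul, Pi.smul_apply, smul_eq_mul]
    positivity
  have hps : ∀ (R : Matrix n n ℝ) (α : ℝ) v, R *ᵥ v ≠ 0 → 0 < focusForm A R α b v v :=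
    fun R α v h => by
      have := gramForm_pos h
      have := gramForm_nonneg (A * R - α • R) v
      simp only [focusForm, _root_.add_apply, FunLike.coe_smul, Pi.smul_apply, smul_eq_mul]
      positivity
  -- The growing form minus the decaying one: along the flow both contribute positively. They cannot
  -- vanish together, because `P v - N v = 4 a A v` and `A` is injective.
  refine ⟨focusForm A P a b - focusForm A N (-a) b, fun v w => ?_, fun v hv => ?_, ?_⟩
  · simp only [_root_.sub_apply]
    rw [focusForm_symm, focusForm_symm A N]
  · simp only [_root_.sub_apply]
    rw [focusForm_mulVec hPc hAAP, focusForm_mulVec hNc hAAN]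
    have h1 := hnn P a v
    have h2 := hnn N (-a) v
    by_cases hPv : P *ᵥ v = 0
    · have hNv : N *ᵥ v ≠ 0 := fun h => hv <| hinj v <| by
        have := hdiff v
        rw [hPv, h, sub_zero] at this
        exact (smul_eq_zero.1 this.symm).resolve_left (by positivity)
      have := hps N (-a) v hNv
      nlinarith
    · have := hps P a v hPv
      nlinarith
  · obtain ⟨w, hw⟩ : ∃ w, P *ᵥ w ≠ 0 := by
      by_contra! h
      exact hne (Matrix.ext_of_mulVec_single fun i => by rw [h, Matrix.zero_mulVec])
    have hNv : N *ᵥ P *ᵥ w = 0 := by rw [Matrix.mulVec_mulVec, hA, Matrix.zero_mulVec]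
    have hPv : P *ᵥ P *ᵥ w ≠ 0 := fun h => hw <| hinj _ <| by
      have := hdiff (P *ᵥ w)
      rw [hNv, h, sub_zero] at this
      exact (smul_eq_zero.1 this.symm).resolve_left (by positivity)
    -- `N` annihilates the range of `P`, so only the growing part survives at this vector.
    refine ⟨P *ᵥ w, ?_⟩
    have h0 : focusForm A N (-a) b (P *ᵥ w) (P *ᵥ w) = 0 := by
      have : (A * N - -a • N) *ᵥ P *ᵥ w = 0 := by
        rw [Matrix.sub_mulVec, Matrix.smul_mulVec, ← Matrix.mulVec_mulVec, hNv]; simp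
      simp only [focusForm, _root_.add_apply, FunLike.coe_smul, Pi.smul_apply, gramForm_apply,
        this, hNv]
      simp
    simp only [_root_.sub_apply]
    rw [h0, sub_zero]
    exact hps P a _ hPv

/-! ## The linearization in terms of the Hessian of the effective potential -/

/-- The matrix of `x'' - 2 y' = p x + q y`, `y'' + 2 x' = q x + s y` in canonical coordinates. -/
def rotatingMatrix {R : Type*} [CommRing R] (p q s : R) : Matrix (Fin 4) (Fin 4) R :=
  !![0, 1, 1, 0; -1, 0, 0, 1; p - 1, q, 0, 1; q, s - 1, -1, 0]

theorem charpoly_rotatingMatrix {R : Type*} [CommRing R] (p q s : R) :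
    (rotatingMatrix p q s).charpoly = X ^ 4 + C (4 - p - s) * X ^ 2 + C (p * s - q ^ 2) := by
  rw [Matrix.charpoly, Matrix.det_succ_row_zero]
  have h4 : (C 4 : R[X]) = 4 := map_ofNat C 4
  simp [h4, rotatingMatrix, Matrix.charmatrix, Matrix.det_fin_three, Fin.sum_univ_succ,
    Matrix.submatrix, Fin.succAbove]
  ring_nf

theorem rotatingMatrix_map (p q s : ℝ) :
    (rotatingMatrix p q s).map Complex.ofReal = rotatingMatrix (p : ℂ) (q : ℂ) (s : ℂ) := by
  ext i j
  fin_cases i <;> fin_cases j <;> simp [rotatingMatrix]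

end ChargedRestricted

namespace ChargedRestricted

open Set Filter Topology Metric Matrix

/-! ## Derivatives of the Hamiltonian -/

/-- Distance from `(x, y)` to `(s, 0)`. -/
noncomputable def axisDist (s : ℝ) (z : Fin 4 → ℝ) : ℝ := √((z 0 - s) ^ 2 + z 1 ^ 2)

theorem rho1_eq_axisDist (μ : ℝ) : rho1 μ = axisDist (-μ) := by
  funext z; simp [rho1, axisDist]

theorem rho2_eq_axisDist (μ : ℝ) : rho2 μ = axisDist (1 - μ) := by
  funext z; simp only [rho2, axisDist]; congr 3; ring

theorem axisDist_sq (s : ℝ) (z : Fin 4 → ℝ) : axisDist s z ^ 2 = (z 0 - s) ^ 2 + z 1 ^ 2 :=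
  Real.sq_sqrt (by positivity)

theorem axisDist_nonneg (s : ℝ) (z : Fin 4 → ℝ) : 0 ≤ axisDist s z := Real.sqrt_nonneg _

theorem continuous_axisDist (s : ℝ) : Continuous (axisDist s) := by
  unfold axisDist; fun_prop

/-- The coordinate one-form `dz i`. -/
noncomputable abbrev coord (i : Fin 4) : (Fin 4 → ℝ) →L[ℝ] ℝ := ContinuousLinearMap.proj i

theorem hasStrictFDerivAt_coord (i : Fin 4) (z : Fin 4 → ℝ) :
    HasStrictFDerivAt (fun z : Fin 4 → ℝ => z i) (coord i) z :=
  (coord i).hasStrictFDerivAt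

section AxisDist

variable {s : ℝ} {z : Fin 4 → ℝ}

theorem hasStrictFDerivAt_axisDist (h : axisDist s z ≠ 0) :
    HasStrictFDerivAt (axisDist s)
      ((axisDist s z)⁻¹ • ((z 0 - s) • coord 0 + z 1 • coord 1)) z := by
  have hx := ((hasStrictFDerivAt_coord 0 z).sub_const s).pow 2
  have hy := (hasStrictFDerivAt_coord 1 z).pow 2
  have hne : (z 0 - s) ^ 2 + z 1 ^ 2 ≠ 0 := by
    rw [← axisDist_sq]; exact pow_ne_zero 2 h
  refine ((hx.add hy).sqrt hne).congr_fderiv ?_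
  change (1 / (2 * axisDist s z)) • _ = _
  ext v
  simp
  field_simp

theorem hasStrictFDerivAt_inv_axisDist (h : axisDist s z ≠ 0) :
    HasStrictFDerivAt (fun z => (axisDist s z)⁻¹)
      (-(((z 0 - s) / axisDist s z ^ 3) • coord 0 + (z 1 / axisDist s z ^ 3) • coord 1)) z := by
  refine ((hasStrictDerivAt_inv h).comp_hasStrictFDerivAt z
    (hasStrictFDerivAt_axisDist h)).congr_fderiv ?_
  ext v
  simp
  field_simp
  ring

theorem hasStrictFDerivAt_inv_axisDist_cube (h : axisDist s z ≠ 0) :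
    HasStrictFDerivAt (fun z => (axisDist s z ^ 3)⁻¹)
      (-((3 * (z 0 - s) / axisDist s z ^ 5) • coord 0 +
        (3 * z 1 / axisDist s z ^ 5) • coord 1)) z := by
  have := (hasStrictFDerivAt_inv_axisDist h).pow 3
  simp only [inv_pow] at this
  refine this.congr_fderiv ?_
  ext v
  simp
  field_simp

theorem hasStrictFDerivAt_force_x (h : axisDist s z ≠ 0) :
    HasStrictFDerivAt (fun z => (z 0 - s) / axisDist s z ^ 3)
      ((1 / axisDist s z ^ 3 - 3 * (z 0 - s) ^ 2 / axisDist s z ^ 5) • coord 0 -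
        (3 * (z 0 - s) * z 1 / axisDist s z ^ 5) • coord 1) z := by
  refine (((hasStrictFDerivAt_coord 0 z).sub_const s).mul
    (hasStrictFDerivAt_inv_axisDist_cube h)).congr_fderiv ?_
  ext v
  simp
  field_simp
  ring

theorem hasStrictFDerivAt_force_y (h : axisDist s z ≠ 0) :
    HasStrictFDerivAt (fun z => z 1 / axisDist s z ^ 3)
      ((1 / axisDist s z ^ 3 - 3 * z 1 ^ 2 / axisDist s z ^ 5) • coord 1 -
        (3 * (z 0 - s) * z 1 / axisDist s z ^ 5) • coord 0) z := by
  refine ((hasStrictFDerivAt_coord 1 z).mul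
    (hasStrictFDerivAt_inv_axisDist_cube h)).congr_fderiv ?_
  ext v
  simp
  field_simp
  ring

end AxisDist

theorem isOpen_phaseSpace (μ : ℝ) : IsOpen (phaseSpace μ) := by
  have h1 : Continuous (rho1 μ) := rho1_eq_axisDist μ ▸ continuous_axisDist _
  have h2 : Continuous (rho2 μ) := rho2_eq_axisDist μ ▸ continuous_axisDist _
  exact (isOpen_ne_fun h1 continuous_const).inter (isOpen_ne_fun h2 continuous_const)

/-- The gradient of the Hamiltonian. -/
noncomputable def hamiltonianGradient (μ β₁ β₂ : ℝ) (z : Fin 4 → ℝ) : Fin 4 → ℝ :=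
  ![-z 3 + (β₁ * (1 - μ) * ((z 0 - -μ) / axisDist (-μ) z ^ 3) +
      β₂ * μ * ((z 0 - (1 - μ)) / axisDist (1 - μ) z ^ 3)),
    z 2 + (β₁ * (1 - μ) * (z 1 / axisDist (-μ) z ^ 3) +
      β₂ * μ * (z 1 / axisDist (1 - μ) z ^ 3)),
    z 2 + z 1, z 3 - z 0]

section Hamiltonian

variable {μ β₁ β₂ : ℝ} {z : Fin 4 → ℝ}

theorem axisDist_ne_zero_of_mem (hz : z ∈ phaseSpace μ) :
    axisDist (-μ) z ≠ 0 ∧ axisDist (1 - μ) z ≠ 0 := by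
  rw [← rho1_eq_axisDist, ← rho2_eq_axisDist]; exact hz

theorem hasStrictFDerivAt_hamiltonian (hz : z ∈ phaseSpace μ) :
    HasStrictFDerivAt (hamiltonian μ β₁ β₂)
      (∑ i, hamiltonianGradient μ β₁ β₂ z i • coord i) z := by
  obtain ⟨h1, h2⟩ := axisDist_ne_zero_of_mem hz
  have c := fun i => hasStrictFDerivAt_coord i z
  have e : hamiltonian μ β₁ β₂ = fun z => (z 2 ^ 2 + z 3 ^ 2) * 2⁻¹ + (z 1 * z 2 - z 0 * z 3) -
      (β₁ * (1 - μ) * (axisDist (-μ) z)⁻¹ + β₂ * μ * (axisDist (1 - μ) z)⁻¹) := by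
    funext z
    simp only [hamiltonian, potential, rho1_eq_axisDist, rho2_eq_axisDist, div_eq_mul_inv]
  rw [e]
  refine (((((c 2).pow 2).add ((c 3).pow 2)).mul_const 2⁻¹).add
    (((c 1).mul (c 2)).sub ((c 0).mul (c 3)))).sub
    (((hasStrictFDerivAt_inv_axisDist h1).const_mul (β₁ * (1 - μ))).add
      ((hasStrictFDerivAt_inv_axisDist h2).const_mul (β₂ * μ))) |>.congr_fderiv ?_
  ext v
  simp [Fin.sum_univ_four, hamiltonianGradient]
  ring

theorem partialDeriv_eq_of_hasStrictFDerivAt {f : (Fin 4 → ℝ) → ℝ} {g : Fin 4 → ℝ}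
    (hf : HasStrictFDerivAt f (∑ i, g i • coord i) z) (i : Fin 4) : partialDeriv i f z = g i := by
  rw [partialDeriv, hf.hasFDerivAt.fderiv]
  simp [Pi.single_apply]

theorem partialDeriv_hamiltonian (hz : z ∈ phaseSpace μ) (i : Fin 4) :
    partialDeriv i (hamiltonian μ β₁ β₂) z = hamiltonianGradient μ β₁ β₂ z i :=
  partialDeriv_eq_of_hasStrictFDerivAt (hasStrictFDerivAt_hamiltonian hz) i

theorem partialDeriv_hamiltonian_eventuallyEq (hz : z ∈ phaseSpace μ) (i : Fin 4) :
    (fun z => hamiltonianGradient μ β₁ β₂ z i) =ᶠ[𝓝 z] partialDeriv i (hamiltonian μ β₁ β₂) := by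
  filter_upwards [(isOpen_phaseSpace μ).mem_nhds hz] with w hw
  exact (partialDeriv_hamiltonian hw i).symm

theorem hamiltonianField_eq (hz : z ∈ phaseSpace μ) :
    hamiltonianField μ β₁ β₂ z = symplecticJ *ᵥ hamiltonianGradient μ β₁ β₂ z := by
  rw [hamiltonianField]
  congr 1
  funext i
  exact partialDeriv_hamiltonian hz i

variable (μ β₁ β₂ z) in
/-- The Hessian of the Hamiltonian. -/
noncomputable def hamiltonianHessian : Matrix (Fin 4) (Fin 4) ℝ :=
  let k₁ := β₁ * (1 - μ) / axisDist (-μ) z ^ 3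
  let k₂ := β₂ * μ / axisDist (1 - μ) z ^ 3
  let c₁ := (z 0 - -μ) / axisDist (-μ) z
  let c₂ := (z 0 - (1 - μ)) / axisDist (1 - μ) z
  let s₁ := z 1 / axisDist (-μ) z
  let s₂ := z 1 / axisDist (1 - μ) z
  !![k₁ * (1 - 3 * c₁ ^ 2) + k₂ * (1 - 3 * c₂ ^ 2), -3 * (k₁ * (c₁ * s₁) + k₂ * (c₂ * s₂)), 0, -1;
    -3 * (k₁ * (c₁ * s₁) + k₂ * (c₂ * s₂)), k₁ * (1 - 3 * s₁ ^ 2) + k₂ * (1 - 3 * s₂ ^ 2), 1, 0;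
    0, 1, 1, 0; -1, 0, 0, 1]

theorem hasStrictFDerivAt_hamiltonianGradient (hz : z ∈ phaseSpace μ) (j : Fin 4) :
    HasStrictFDerivAt (fun z => hamiltonianGradient μ β₁ β₂ z j)
      (∑ i, hamiltonianHessian μ β₁ β₂ z i j • coord i) z := by
  obtain ⟨h1, h2⟩ := axisDist_ne_zero_of_mem hz
  have c := fun i => hasStrictFDerivAt_coord i z
  fin_cases j
  · refine ((c 3).neg.add (((hasStrictFDerivAt_force_x h1).const_mul (β₁ * (1 - μ))).add
      ((hasStrictFDerivAt_force_x h2).const_mul (β₂ * μ)))).congr_fderiv ?_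
    ext v
    simp [Fin.sum_univ_four, hamiltonianHessian]
    field_simp
    ring
  · refine ((c 2).add (((hasStrictFDerivAt_force_y h1).const_mul (β₁ * (1 - μ))).add
      ((hasStrictFDerivAt_force_y h2).const_mul (β₂ * μ)))).congr_fderiv ?_
    ext v
    simp [Fin.sum_univ_four, hamiltonianHessian]
    field_simp
    ring
  · refine ((c 2).add (c 1)).congr_fderiv ?_
    ext v
    simp [Fin.sum_univ_four, hamiltonianHessian]
    ring
  · refine ((c 3).sub (c 0)).congr_fderiv ?_
    ext v
    simp [Fin.sum_univ_four, hamiltonianHessian]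
    ring

theorem linearizationMatrix_eq (hz : z ∈ phaseSpace μ) :
    linearizationMatrix μ β₁ β₂ z = symplecticJ * hamiltonianHessian μ β₁ β₂ z := by
  rw [linearizationMatrix]
  congr 1
  ext i j
  exact partialDeriv_eq_of_hasStrictFDerivAt ((hasStrictFDerivAt_hamiltonianGradient hz j)
    |>.congr_of_eventuallyEq (partialDeriv_hamiltonian_eventuallyEq hz j)) i

theorem hamiltonianHessian_transpose :
    (hamiltonianHessian μ β₁ β₂ z)ᵀ = hamiltonianHessian μ β₁ β₂ z := by
  ext i j
  fin_cases i <;> fin_cases j <;> rfl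

/-- Strictness is what makes the field Lipschitz near `z`, as the instability criterion requires. -/
theorem hasStrictFDerivAt_hamiltonianField (hz : z ∈ phaseSpace μ) :
    HasStrictFDerivAt (hamiltonianField μ β₁ β₂)
      (linearizationMatrix μ β₁ β₂ z).mulVecLin.toContinuousLinearMap z := by
  have hg : HasStrictFDerivAt (hamiltonianGradient μ β₁ β₂)
      (hamiltonianHessian μ β₁ β₂ z).mulVecLin.toContinuousLinearMap z := by
    refine hasStrictFDerivAt_pi'.2 fun j => ?_
    refine (hasStrictFDerivAt_hamiltonianGradient hz j).congr_fderiv ?_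
    ext v
    have h : ∀ i, hamiltonianHessian μ β₁ β₂ z i j = hamiltonianHessian μ β₁ β₂ z j i := fun i =>
      congrFun (congrFun hamiltonianHessian_transpose j) i
    simp only [h]
    simp [Matrix.mulVec, dotProduct]
  have hJ := symplecticJ.mulVecLin.toContinuousLinearMap.hasStrictFDerivAt
    (x := hamiltonianGradient μ β₁ β₂ z)
  have hev : (fun w => symplecticJ *ᵥ hamiltonianGradient μ β₁ β₂ w) =ᶠ[𝓝 z]
      hamiltonianField μ β₁ β₂ := by
    filter_upwards [(isOpen_phaseSpace μ).mem_nhds hz] with w hw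
    exact (hamiltonianField_eq hw).symm
  refine ((hJ.comp z hg).congr_fderiv ?_).congr_of_eventuallyEq hev
  ext v
  simp [linearizationMatrix_eq hz, Matrix.mulVec_mulVec]

end Hamiltonian

end ChargedRestricted

namespace ChargedRestricted

open Set Filter Topology Metric Matrix Polynomial

/-! ## Spectral cases for the rotating matrix -/

section Ring

variable {R : Type*} [CommRing R] {p q s : R}

theorem charpoly_rotatingMatrix_of_trace (h : p + s = 3) :
    (rotatingMatrix p q s).charpoly = X ^ 4 + X ^ 2 + C (p * s - q ^ 2) := by
  have : 4 - p - s = 1 := by linear_combination -h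
  simp [charpoly_rotatingMatrix, this]

/-- The entry in row 0, column 3 is `2`, whatever the parameters: the Coriolis coupling prevents a
quadratic minimal polynomial. -/
theorem rotatingMatrix_sq_add_smul_ne_zero [CharZero R] (k l : R) :
    rotatingMatrix p q s * rotatingMatrix p q s + l • rotatingMatrix p q s + k • 1 ≠ 0 := by
  intro h
  have := congrFun (congrFun h 0) 3
  simp [rotatingMatrix] at this
  norm_num at this

/-- The entries `(0, 2)` and `(1, 3)` are `p - 3` and `s - 3`; they sum to `-3`, so they cannot both
vanish. -/
theorem rotatingMatrix_cube_add_ne_zero [CharZero R] (h : p + s = 3) :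
    rotatingMatrix p q s * rotatingMatrix p q s * rotatingMatrix p q s +
      rotatingMatrix p q s ≠ 0 := by
  intro h0
  have h1 := congrFun (congrFun h0 0) 2
  have h2 := congrFun (congrFun h0 1) 3
  simp [rotatingMatrix] at h1 h2
  have h3 : (3 : R) = 0 := by linear_combination -h1 - h2 + h
  norm_num at h3

end Ring

section Real

variable {p q s : ℝ}

theorem rotatingMatrix_relation (h : p + s = 3) :
    rotatingMatrix p q s * rotatingMatrix p q s * (rotatingMatrix p q s * rotatingMatrix p q s) +
      rotatingMatrix p q s * rotatingMatrix p q s +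
      (p * s - q ^ 2) • (1 : Matrix (Fin 4) (Fin 4) ℝ) = 0 := by
  have := Matrix.aeval_self_charpoly (rotatingMatrix p q s)
  rw [charpoly_rotatingMatrix_of_trace h] at this
  simp only [map_add, map_pow, aeval_X, aeval_C, Algebra.algebraMap_eq_smul_one] at this
  rw [← this]
  noncomm_ring

/-- With `r = √c`, `λ⁴ + λ² + c = (λ² - a λ + r)(λ² + a λ + r)` for `a² = 2 r - 1`, which is
positive as `c > 1/4`. The roots are `±a/2 ± i b/2` with `b² = 2 r + 1`. -/
theorem exists_growing_form_rotatingMatrix (h : p + s = 3) (hc : 1 / 4 < p * s - q ^ 2) :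
    ∃ B : (Fin 4 → ℝ) →L[ℝ] (Fin 4 → ℝ) →L[ℝ] ℝ, (∀ v w, B v w = B w v) ∧
      (∀ v, v ≠ 0 → 0 < B v (rotatingMatrix p q s *ᵥ v)) ∧ ∃ v₀, 0 < B v₀ v₀ := by
  set c := p * s - q ^ 2 with hcdef
  have hr : 1 / 2 < √c := Real.lt_sqrt_of_sq_lt (by linarith)
  have hrr : √c ^ 2 = c := Real.sq_sqrt (by linarith)
  set r := √c
  have ha : √(2 * r - 1) ^ 2 = 2 * r - 1 := Real.sq_sqrt (by linarith)
  have hb : √(2 * r + 1) ^ 2 = 2 * r + 1 := Real.sq_sqrt (by linarith)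
  have ha0 : 0 < √(2 * r - 1) := Real.sqrt_pos.2 (by linarith)
  have hb0 : 0 < √(2 * r + 1) := Real.sqrt_pos.2 (by linarith)
  set a := √(2 * r - 1)
  set b := √(2 * r + 1)
  have hab : (a / 2) ^ 2 + (b / 2) ^ 2 = r := by linarith
  have hrel := rotatingMatrix_relation (q := q) h
  refine exists_growing_form (half_pos ha0) (half_pos hb0) (fun v hv => ?_) ?_ ?_
  · have h1 := congrArg (· *ᵥ v) hrel
    simp only [Matrix.add_mulVec, ← Matrix.mulVec_mulVec, hv, Matrix.mulVec_zero,
      Matrix.smul_mulVec, Matrix.one_mulVec, Matrix.zero_mulVec, zero_add] at h1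
    exact (smul_eq_zero.1 h1).resolve_left (by linarith)
  · rw [hab, mul_div_cancel₀ a two_ne_zero, ← hrel, ← hcdef, ← hrr]
    -- Writing the coefficient `1` of `A²` as `2 r - a ^ 2` turns the factorization into a formal
    -- identity in `r` and `a`.
    have h1 : rotatingMatrix p q s * rotatingMatrix p q s * (rotatingMatrix p q s *
        rotatingMatrix p q s) + rotatingMatrix p q s * rotatingMatrix p q s =
        rotatingMatrix p q s * rotatingMatrix p q s * (rotatingMatrix p q s *
        rotatingMatrix p q s) + (2 * r - a ^ 2) • (rotatingMatrix p q s *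
        rotatingMatrix p q s) := by rw [ha]; simp
    rw [h1]
    simp only [Matrix.mul_add, Matrix.add_mul, Matrix.sub_mul, Matrix.smul_mul, Matrix.mul_smul,
      Matrix.mul_one, Matrix.one_mul, Matrix.mul_assoc]
    module
  · exact rotatingMatrix_sq_add_smul_ne_zero _ _

/-- The values of `λ²` are `-(1 ± √(1 - 4 c)) / 2`, distinct and negative for `0 < c < 1/4`. -/
theorem isLyapunovStable_rotatingMatrix (h : p + s = 3) (hc0 : 0 < p * s - q ^ 2)
    (hc : p * s - q ^ 2 < 1 / 4) : IsLyapunovStable (rotatingMatrix p q s).mulVec univ 0 := by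
  set c := p * s - q ^ 2 with hcdef
  have hF : √(1 - 4 * c) ^ 2 = 1 - 4 * c := Real.sq_sqrt (by linarith)
  have hF0 : 0 < √(1 - 4 * c) := Real.sqrt_pos.2 (by linarith)
  set F := √(1 - 4 * c)
  have hF1 : F < 1 := by nlinarith
  refine isLyapunovStable_of_imaginary (k := (1 + F) / 2) (l := (1 - F) / 2) (by linarith)
    (by linarith) (by linarith) ?_
  rw [← rotatingMatrix_relation (q := q) h, ← hcdef]
  have : c = (1 + F) / 2 * ((1 - F) / 2) := by linear_combination hF / 4
  rw [this]
  simp only [Matrix.mul_add, Matrix.add_mul, Matrix.smul_mul, Matrix.mul_smul,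
    Matrix.mul_one, Matrix.one_mul, Matrix.mul_assoc]
  module

/-- `N = A² + 1/2` is nonzero with `N² = 0`, so any `v` with `N v ≠ 0` starts a Jordan chain at
`±i/√2`. -/
theorem rotatingMatrix_resonant (h : p + s = 3) (hc : p * s - q ^ 2 = 1 / 4) :
    ¬ IsLyapunovStable (rotatingMatrix p q s).mulVec univ 0 := by
  set N := rotatingMatrix p q s * rotatingMatrix p q s +
    (1 / 2 : ℝ) • (1 : Matrix (Fin 4) (Fin 4) ℝ) with hN
  have hNN : (rotatingMatrix p q s * rotatingMatrix p q s) * N = -(1 / 2 : ℝ) • N := by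
    have h1 := rotatingMatrix_relation (q := q) h
    rw [hc] at h1
    rw [← sub_eq_zero, ← h1, hN]
    simp only [Matrix.mul_add, Matrix.mul_smul, Matrix.mul_one]
    module
  obtain ⟨v, hv⟩ : ∃ v, N *ᵥ v ≠ 0 := by
    by_contra! hv
    have := rotatingMatrix_sq_add_smul_ne_zero (p := p) (q := q) (s := s) (1 / 2) 0
    rw [zero_smul, add_zero] at this
    exact this (Matrix.ext_of_mulVec_single fun i => by rw [hv, Matrix.zero_mulVec])
  have hω : √(1 / 2 : ℝ) ^ 2 = 1 / 2 := Real.sq_sqrt (by norm_num)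
  refine not_isLyapunovStable_of_jordan_imaginary (ω := √(1 / 2)) (v := v) (w := N *ᵥ v)
    (Real.sqrt_pos.2 (by norm_num)) ?_ ?_ hv
  · rw [hω, hN, Matrix.add_mulVec, Matrix.smul_mulVec, Matrix.one_mulVec, Matrix.mulVec_mulVec]
    abel
  · rw [hω, Matrix.mulVec_mulVec, Matrix.mulVec_mulVec, hNN, Matrix.smul_mulVec]

/-- Here `A² (A² + 1) = 0` but `A (A² + 1) ≠ 0`, so a vector `(A² + 1) v` lies in a Jordan block at
the eigenvalue `0`. -/
theorem rotatingMatrix_degenerate (h : p + s = 3) (hc : p * s - q ^ 2 = 0) :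
    ¬ IsLyapunovStable (rotatingMatrix p q s).mulVec univ 0 := by
  obtain ⟨v, hv⟩ : ∃ v, (rotatingMatrix p q s * rotatingMatrix p q s * rotatingMatrix p q s +
      rotatingMatrix p q s) *ᵥ v ≠ 0 := by
    by_contra! hv
    exact rotatingMatrix_cube_add_ne_zero h
      (Matrix.ext_of_mulVec_single fun i => by rw [hv, Matrix.zero_mulVec])
  have h1 := rotatingMatrix_relation (q := q) h
  rw [hc, zero_smul, add_zero] at h1
  refine not_isLyapunovStable_of_jordan_zero
    (v := (rotatingMatrix p q s * rotatingMatrix p q s + 1) *ᵥ v) ?_ ?_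
  · rwa [Matrix.mulVec_mulVec, Matrix.mul_add, Matrix.mul_one, ← Matrix.mul_assoc]
  · rw [Matrix.mulVec_mulVec, Matrix.mulVec_mulVec, Matrix.mul_add,
      Matrix.mul_one, h1, Matrix.zero_mulVec]

end Real

section Complex

variable {p q s : ℂ}

theorem rotatingMatrix_resonant_complex (h : p + s = 3) (hc : p * s - q ^ 2 = 1 / 4) :
    HasRepeatedEigenvalue (rotatingMatrix p q s) ∧ ¬ IsDiagonalizable (rotatingMatrix p q s) := by
  have hch : (rotatingMatrix p q s).charpoly = (X ^ 2 + C (1 / 2)) ^ 2 := by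
    rw [charpoly_rotatingMatrix_of_trace h, hc]
    have h1 : (C (1 / 4) : ℂ[X]) = C (1 / 2) ^ 2 := by rw [← C_pow]; norm_num
    have h2 : (2 : ℂ[X]) * C (1 / 2) = 1 := by
      rw [← map_ofNat C 2, ← C_mul]; norm_num
    rw [h1]
    linear_combination -X ^ 2 * h2
  constructor
  · obtain ⟨a, ha⟩ := IsAlgClosed.exists_pow_nat_eq (-(1 / 2) : ℂ) two_pos
    refine hasRepeatedEigenvalue_of_dvd (a := a) ?_
    rw [hch]
    refine pow_dvd_pow_of_dvd ⟨X + C a, ?_⟩ 2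
    have h1 : (C a : ℂ[X]) ^ 2 = -C (1 / 2) := by rw [← C_pow, ha, C_neg]
    linear_combination h1
  · intro hd
    have := hd.aeval_eq_zero (f := X ^ 2 + C (1 / 2))
      (by rw [← hch]; exact Matrix.aeval_self_charpoly _)
    refine rotatingMatrix_sq_add_smul_ne_zero (p := p) (q := q) (s := s) (1 / 2) 0 ?_
    rw [← this]
    simp [Algebra.algebraMap_eq_smul_one, pow_two]

theorem rotatingMatrix_degenerate_complex (h : p + s = 3) (hc : p * s - q ^ 2 = 0) :
    HasRepeatedEigenvalue (rotatingMatrix p q s) ∧ ¬ IsDiagonalizable (rotatingMatrix p q s) := by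
  have hch : (rotatingMatrix p q s).charpoly = X ^ 4 + X ^ 2 := by
    rw [charpoly_rotatingMatrix_of_trace h, hc]; simp
  constructor
  · refine hasRepeatedEigenvalue_of_dvd (a := 0) ⟨X ^ 2 + 1, ?_⟩
    rw [hch]; simp; ring
  · intro hd
    -- The square of `X³ + X` is a multiple of the characteristic polynomial `X⁴ + X²`, hence kills
    -- the matrix.
    have := hd.aeval_eq_zero (f := X ^ 3 + X) (by
      have : (X ^ 3 + X : ℂ[X]) ^ 2 = (X ^ 2 + 1) * (rotatingMatrix p q s).charpoly := by
        rw [hch]; ring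
      rw [this, map_mul, Matrix.aeval_self_charpoly, mul_zero])
    refine rotatingMatrix_cube_add_ne_zero h (q := q) ?_
    rw [← this]
    simp [pow_succ]

end Complex

/-! ## The equilibria -/

section Equilibria

variable {μ β₁ β₂ : ℝ} {z : Fin 4 → ℝ}

variable (μ β₁ β₂ z) in
/-- The conditions characterising the triangular equilibria and their collinear limits. -/
structure IsBalanced : Prop where
  mem : z ∈ phaseSpace μ
  charge₁ : β₁ = axisDist (-μ) z ^ 3
  charge₂ : β₂ = axisDist (1 - μ) z ^ 3
  momentum_x : z 2 = -z 1
  momentum_y : z 3 = z 0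

theorem symplecticJ_mulVec (g : Fin 4 → ℝ) : symplecticJ *ᵥ g = ![g 2, g 3, -g 0, -g 1] := by
  funext i
  fin_cases i <;> simp [symplecticJ, Matrix.mulVec, dotProduct, Fin.sum_univ_four]

/-- Let `K`, `L` be the pulls `β₁ (1 - μ) / ρ₁³` and `β₂ μ / ρ₂³`. The `y`-equation divided by `y ≠
0` gives `K + L = 1`; the `x`-equation then forces `K = 1 - μ` and `L = μ`. -/
theorem IsTriangularEquilibrium.isBalanced (h : IsTriangularEquilibrium μ β₁ β₂ z) (hμ₀ : μ ≠ 0)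
    (hμ₁ : 1 - μ ≠ 0) : IsBalanced μ β₁ β₂ z := by
  obtain ⟨⟨hz, hX⟩, hy⟩ := h
  obtain ⟨h1, h2⟩ := axisDist_ne_zero_of_mem hz
  rw [hamiltonianField_eq hz, symplecticJ_mulVec] at hX
  have e0 := congrFun hX 0
  have e1 := congrFun hX 1
  have e2 := congrFun hX 2
  have e3 := congrFun hX 3
  simp [hamiltonianGradient] at e0 e1 e2 e3
  obtain ⟨K, hK⟩ : ∃ K, K = β₁ * (1 - μ) / axisDist (-μ) z ^ 3 := ⟨_, rfl⟩
  obtain ⟨L, hL⟩ : ∃ L, L = β₂ * μ / axisDist (1 - μ) z ^ 3 := ⟨_, rfl⟩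
  have hKL : K + L = 1 := by
    refine mul_left_cancel₀ hy ?_
    rw [hK, hL]
    linear_combination -e3 - e0
  have hKμ : K = 1 - μ := by
    have : K * (z 0 + μ) + L * (z 0 - (1 - μ)) = z 0 := by
      rw [hK, hL]
      linear_combination -e2 + e1
    linear_combination this - (z 0 - (1 - μ)) * hKL
  have hLμ : L = μ := by linarith
  refine ⟨hz, ?_, ?_, by linarith, by linarith⟩
  · rw [hKμ, eq_div_iff (pow_ne_zero 3 h1)] at hK
    exact mul_right_cancel₀ hμ₁ (by linear_combination -hK)
  · rw [hLμ, eq_div_iff (pow_ne_zero 3 h2)] at hL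
    exact mul_right_cancel₀ hμ₀ (by linear_combination -hL)

theorem rpow_third_pow_three {x : ℝ} (hx : 0 ≤ x) : (x ^ (1 / 3 : ℝ)) ^ 3 = x := by
  rw [← Real.rpow_natCast, ← Real.rpow_mul hx]
  norm_num

/-- On the axis distances are absolute values, and in each case the relation between the cube roots
places the body at distance `βᵢ ^ (1/3)` from the `i`-th primary. -/
theorem IsCollinearLimit.isBalanced (h : IsCollinearLimit μ β₁ β₂ z) :
    IsBalanced μ β₁ β₂ z := by
  obtain ⟨h1, h2, h⟩ := h
  have c1 := rpow_third_pow_three h1.le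
  have c2 := rpow_third_pow_three h2.le
  have p1 : 0 < β₁ ^ (1 / 3 : ℝ) := Real.rpow_pos_of_pos h1 _
  have p2 : 0 < β₂ ^ (1 / 3 : ℝ) := Real.rpow_pos_of_pos h2 _
  generalize β₁ ^ (1 / 3 : ℝ) = r₁ at *
  generalize β₂ ^ (1 / 3 : ℝ) = r₂ at *
  obtain ⟨x, rfl, hx1, hx2⟩ : ∃ x, z = restState x 0 ∧ |x - -μ| = r₁ ∧ |x - (1 - μ)| = r₂ := by
    rcases h with ⟨h, rfl⟩ | ⟨h, rfl⟩ | ⟨h, rfl⟩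
    · refine ⟨_, rfl, ?_, ?_⟩ <;> rw [abs_of_neg] <;> linarith
    · refine ⟨_, rfl, ?_, ?_⟩
      · rw [abs_of_pos] <;> linarith
      · rw [abs_of_neg] <;> linarith
    · refine ⟨_, rfl, ?_, ?_⟩ <;> rw [abs_of_pos] <;> linarith
  have d : ∀ s, axisDist s (restState x 0) = |x - s| := fun s => by
    simp [axisDist, restState, Real.sqrt_sq_eq_abs]
  refine ⟨?_, by rw [d, hx1, c1], by rw [d, hx2, c2], by simp [restState], by simp [restState]⟩
  rw [phaseSpace, rho1_eq_axisDist, rho2_eq_axisDist]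
  exact ⟨by rw [d, hx1]; exact p1.ne', by rw [d, hx2]; exact p2.ne'⟩

namespace IsBalanced

theorem isEquilibrium (h : IsBalanced μ β₁ β₂ z) : IsEquilibrium μ β₁ β₂ z := by
  obtain ⟨h1, h2⟩ := axisDist_ne_zero_of_mem h.mem
  refine ⟨h.mem, ?_⟩
  rw [hamiltonianField_eq h.mem, symplecticJ_mulVec]
  funext i
  fin_cases i
  · simp [hamiltonianGradient, h.momentum_x]
  · simp [hamiltonianGradient, h.momentum_y]
  · simp [hamiltonianGradient, h.momentum_y, h.charge₁, h.charge₂]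
    field_simp
    ring
  · simp [hamiltonianGradient, h.momentum_x, h.charge₁, h.charge₂]
    field_simp
    ring

/-- With `uᵢ = (cᵢ, sᵢ)` of length one, the block is `3 ((1 - μ) u₁ u₁ᵀ + μ u₂ u₂ᵀ)`. Its
determinant is `9 μ (1 - μ)` times the squared cross product of `u₁` and `u₂`, which is `y / (ρ₁
ρ₂)` because the primaries are at unit distance. -/
theorem linearizationMatrix_eq (h : IsBalanced μ β₁ β₂ z) : ∃ p q s : ℝ,
    linearizationMatrix μ β₁ β₂ z = rotatingMatrix p q s ∧ p + s = 3 ∧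
      p * s - q ^ 2 = 9 * μ * (1 - μ) * (z 1 / (axisDist (-μ) z * axisDist (1 - μ) z)) ^ 2 := by
  obtain ⟨h1, h2⟩ := axisDist_ne_zero_of_mem h.mem
  have hk₁ : β₁ * (1 - μ) / axisDist (-μ) z ^ 3 = 1 - μ := by rw [h.charge₁]; field_simp
  have hk₂ : β₂ * μ / axisDist (1 - μ) z ^ 3 = μ := by rw [h.charge₂]; field_simp
  obtain ⟨c₁, hc₁⟩ : ∃ c₁, c₁ = (z 0 - -μ) / axisDist (-μ) z := ⟨_, rfl⟩
  obtain ⟨c₂, hc₂⟩ : ∃ c₂, c₂ = (z 0 - (1 - μ)) / axisDist (1 - μ) z := ⟨_, rfl⟩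
  obtain ⟨s₁, hs₁⟩ : ∃ s₁, s₁ = z 1 / axisDist (-μ) z := ⟨_, rfl⟩
  obtain ⟨s₂, hs₂⟩ : ∃ s₂, s₂ = z 1 / axisDist (1 - μ) z := ⟨_, rfl⟩
  have e₁ : c₁ ^ 2 + s₁ ^ 2 = 1 := by
    rw [hc₁, hs₁, div_pow, div_pow, ← add_div, ← axisDist_sq, div_self (pow_ne_zero 2 h1)]
  have e₂ : c₂ ^ 2 + s₂ ^ 2 = 1 := by
    rw [hc₂, hs₂, div_pow, div_pow, ← add_div, ← axisDist_sq, div_self (pow_ne_zero 2 h2)]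
  have e₃ : z 1 / (axisDist (-μ) z * axisDist (1 - μ) z) = c₁ * s₂ - c₂ * s₁ := by
    rw [hc₁, hc₂, hs₁, hs₂]
    field_simp
    ring
  refine ⟨3 * ((1 - μ) * c₁ ^ 2 + μ * c₂ ^ 2), 3 * ((1 - μ) * (c₁ * s₁) + μ * (c₂ * s₂)),
    3 * ((1 - μ) * s₁ ^ 2 + μ * s₂ ^ 2), ?_, ?_, ?_⟩
  · rw [ChargedRestricted.linearizationMatrix_eq h.mem]
    simp only [hamiltonianHessian, hk₁, hk₂, ← hc₁, ← hc₂, ← hs₁, ← hs₂]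
    ext i j
    fin_cases i <;> fin_cases j <;>
      simp [symplecticJ, rotatingMatrix, Matrix.mul_apply, Fin.sum_univ_four] <;> ring
  · linear_combination 3 * (1 - μ) * e₁ + 3 * μ * e₂
  · rw [e₃]
    ring

end IsBalanced

/-- The angle at a point `(s, 0)` between `z` and a point at distance one on the axis. -/
theorem cos_sin_angle_axis {s e : ℝ} (he : e ^ 2 = 1) (hz : axisDist s z ≠ 0) :
    Real.cos (EuclideanGeometry.angle (!₂[z 0, z 1] : EuclideanSpace ℝ (Fin 2)) !₂[s, 0]
      !₂[s + e, 0]) = e * (z 0 - s) / axisDist s z ∧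
    Real.sin (EuclideanGeometry.angle (!₂[z 0, z 1] : EuclideanSpace ℝ (Fin 2)) !₂[s, 0]
      !₂[s + e, 0]) = |z 1| / axisDist s z := by
  have hcos : Real.cos (EuclideanGeometry.angle (!₂[z 0, z 1] : EuclideanSpace ℝ (Fin 2)) !₂[s, 0]
      !₂[s + e, 0]) = e * (z 0 - s) / axisDist s z := by
    rw [EuclideanGeometry.angle, InnerProductGeometry.cos_angle]
    have h1 : ‖(!₂[z 0, z 1] : EuclideanSpace ℝ (Fin 2)) -ᵥ !₂[s, 0]‖ = axisDist s z := by
      simp [EuclideanSpace.norm_eq, axisDist]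
    have h2 : ‖(!₂[s + e, 0] : EuclideanSpace ℝ (Fin 2)) -ᵥ !₂[s, 0]‖ = 1 := by
      simp [EuclideanSpace.norm_eq, he]
    rw [h1, h2, mul_one]
    congr 1
    simp [PiLp.inner_apply]
  refine ⟨hcos, ?_⟩
  have hnn : 0 ≤ |z 1| / axisDist s z := div_nonneg (abs_nonneg _) (axisDist_nonneg s z)
  refine (pow_left_inj₀ (EuclideanGeometry.angle_nonneg _ _ _ |> fun h =>
    Real.sin_nonneg_of_nonneg_of_le_pi h (EuclideanGeometry.angle_le_pi _ _ _)) hnn two_ne_zero).1 ?_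
  rw [Real.sin_sq, hcos]
  field_simp
  rw [sq_abs, axisDist_sq]
  linear_combination -(z 0 - s) ^ 2 * he

/-- By the addition formula the numerators combine to `|y| ((x + μ) - (x - 1 + μ)) = |y|`. No
condition `y ≠ 0` enters, so the collinear limits are covered too. -/
theorem sin_gammaAngle_sq (hz : z ∈ phaseSpace μ) : Real.sin (gammaAngle μ z) ^ 2 =
    (z 1 / (axisDist (-μ) z * axisDist (1 - μ) z)) ^ 2 := by
  obtain ⟨h1, h2⟩ := axisDist_ne_zero_of_mem hz
  obtain ⟨c₁, s₁⟩ := cos_sin_angle_axis (e := 1) (by norm_num) h1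
  obtain ⟨c₂, s₂⟩ := cos_sin_angle_axis (e := -1) (by norm_num) h2
  rw [show -μ + 1 = 1 - μ by ring] at c₁ s₁
  rw [show 1 - μ + -1 = -μ by ring] at c₂ s₂
  simp only [gammaAngle]
  rw [Real.sin_add, c₁, s₁, c₂, s₂, ← sq_abs (z 1 / _), abs_div,
    abs_of_nonneg (mul_nonneg (axisDist_nonneg _ _) (axisDist_nonneg _ _))]
  congr 1
  field_simp
  ring

end Equilibria

end ChargedRestricted

/-! ### The four cases according to the discriminant `1 - 4 c` -/

open ChargedRestricted in
theorem theorem5p1 (μ β₁ β₂ : ℝ) (hμ₀ : 0 < μ) (hμ : μ ≤ 1 / 2)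
    (hβ : (β₁ - 1) * (β₂ - 1) < 1) (z : Fin 4 → ℝ)
    (hz : ChargedRestricted.IsTriangularEquilibrium μ β₁ β₂ z ∨
      ChargedRestricted.IsCollinearLimit μ β₁ β₂ z) :
    ChargedRestricted.IsEquilibrium μ β₁ β₂ z ∧
    (ChargedRestricted.stabilityF μ (ChargedRestricted.gammaAngle μ z) < 0 →
      ¬ ChargedRestricted.IsStableEquilibrium μ β₁ β₂ z) ∧
    (ChargedRestricted.stabilityF μ (ChargedRestricted.gammaAngle μ z) = 0 →
      ¬ ChargedRestricted.IsLinearlyStable μ β₁ β₂ z ∧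
      ChargedRestricted.HasRepeatedEigenvalue (ChargedRestricted.complexLinearization μ β₁ β₂ z) ∧
      ¬ ChargedRestricted.IsDiagonalizable (ChargedRestricted.complexLinearization μ β₁ β₂ z)) ∧
    (0 < ChargedRestricted.stabilityF μ (ChargedRestricted.gammaAngle μ z) ∧
        ChargedRestricted.stabilityF μ (ChargedRestricted.gammaAngle μ z) < 1 →
      ChargedRestricted.IsLinearlyStable μ β₁ β₂ z) ∧
    (ChargedRestricted.stabilityF μ (ChargedRestricted.gammaAngle μ z) = 1 →
      ¬ ChargedRestricted.IsLinearlyStable μ β₁ β₂ z ∧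
      ChargedRestricted.HasRepeatedEigenvalue (ChargedRestricted.complexLinearization μ β₁ β₂ z) ∧
      ¬ ChargedRestricted.IsDiagonalizable (ChargedRestricted.complexLinearization μ β₁ β₂ z)) := by
  have hb : IsBalanced μ β₁ β₂ z := 
    hz.elim (·.isBalanced hμ₀.ne' (by linarith)) (·.isBalanced)
  obtain ⟨p, q, s, hA, htr, hdet⟩ := hb.linearizationMatrix_eq
  have hF : stabilityF μ (gammaAngle μ z) = 1 - 4 * (p * s - q ^ 2) := by
    rw [stabilityF, sin_gammaAngle_sq hb.mem, hdet]; ring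
  have htr' : (p : ℂ) + s = 3 := by exact_mod_cast htr
  have hdet' : (p : ℂ) * s - q ^ 2 = ((p * s - q ^ 2 : ℝ) : ℂ) := by push_cast; rfl
  rw [hF]
  simp only [IsLinearlyStable, complexLinearization, hA, rotatingMatrix_map]
  refine ⟨hb.isEquilibrium, fun h => ?_, fun h => ?_, fun h => ?_, fun h => ?_⟩
  · obtain ⟨B, hsymm, hpos, v₀, hv₀⟩ :=
      exists_growing_form_rotatingMatrix htr (show 1 / 4 < p * s - q ^ 2 by linarith)
    refine not_isLyapunovStable_of_quadratic ((isOpen_phaseSpace μ).mem_nhds hb.mem)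
      (hasStrictFDerivAt_hamiltonianField hb.mem) hb.isEquilibrium.2 B hsymm ?_ hv₀
    rw [hA]
    exact hpos
  · have hc : p * s - q ^ 2 = 1 / 4 := by linarith
    exact ⟨rotatingMatrix_resonant htr hc,
      rotatingMatrix_resonant_complex htr' (by rw [hdet', hc]; norm_num)⟩
  · exact isLyapunovStable_rotatingMatrix htr (by linarith) (by linarith)
  · have hc : p * s - q ^ 2 = 0 := by linarith
    exact ⟨rotatingMatrix_degenerate htr hc,
      rotatingMatrix_degenerate_complex htr' (by rw [hdet', hc]; norm_num)⟩
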